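/- Let $\sigma>0$, $r\ge 0$, $\mu\ge 0$. The coalescing branching random walk (CBRW) on the lattice $\sigma\mathbb{Z}$ with branching rate $r$ and coalescence rate $\mu$ is the continuous-time Markov jump process of finite particle configurations on $\sigma\mathbb{Z}$, started from a single particle at the origin, in which independently each particle at $x$ jumps to $x+\sigma$ at rate $1/2$ and to $x-\sigma$ at rate $1/2$, each particle branches at rate $r$ into two particles on the same site, and each pair of particles on the same site coalesces into one particle at rate $\mu$. Let $X_{\max}(t)$ be the position of the rightmost particle at time $t$. Then for every $v\in\mathbb{R}$ one has $\mathbf{P}(X_{\max}(t)\ge vt)>0$ for all $t>0$, and the limit $$\lim_{t\to\infty}\frac1t\,\ln \mathbf{P}\big(X_{\max}(t)\ge vt\big)\in(-\infty,0]$$ exists (along real $t\to\infty$) and is finite. That is, there is a number $\psi_{\rm CBRW}(v)\in[0,\infty)$ such that $\lim_{t\to\infty}\frac1t\ln \mathbf{P}(X_{\max}(t)\ge vt)=-\psi_{\rm CBRW}(v)$. -/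

import Mathlib

open MeasureTheory ProbabilityTheory Filter Topology
open scoped NNReal ENNReal

namespace CBRW

/-- A finite particle configuration: `η x` is the number of particles at the lattice site with
index `x : ℤ`, that is at the point `σ * x` of the lattice `σℤ`. -/
abbrev Config : Type := ℤ →₀ ℕ

/-- The countable set of configurations carries the discrete σ-algebra. -/
instance : MeasurableSpace Config := ⊤

instance : DiscreteMeasurableSpace Config := ⟨fun _ => trivial⟩

/-- A single particle at site `x`. -/
noncomputable def single (x : ℤ) : Config := Finsupp.single x 1

/-- The measure `Λ(η, ·)` of transition rates out of `η`, for branching rate `r` and coalescence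
rate `μ`. At each occupied site `x`: each particle jumps to `x + 1` at rate `1/2` and to `x - 1`
at rate `1/2`, each particle is replaced by two particles at `x` at rate `r`, and each unordered
pair of particles at `x` merges into one particle at rate `μ`. -/
noncomputable def rates (r μ : ℝ≥0) (η : Config) : Measure Config :=
  ∑ x ∈ η.support,
    (((η x : ℝ≥0) * (1 / 2)) • Measure.dirac (η - single x + single (x + 1))
      + ((η x : ℝ≥0) * (1 / 2)) • Measure.dirac (η - single x + single (x - 1))
      + ((η x : ℝ≥0) * r) • Measure.dirac (η + single x)
      + (((η x).choose 2 : ℝ≥0) * μ) • Measure.dirac (η - single x))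

/-- The total transition rate out of `η`. -/
noncomputable def exitRate (r μ : ℝ≥0) (η : Config) : ℝ≥0 :=
  ∑ x ∈ η.support, ((η x : ℝ≥0) * (1 + r) + ((η x).choose 2 : ℝ≥0) * μ)

theorem rates_univ (r μ : ℝ≥0) (η : Config) : rates r μ η Set.univ = exitRate r μ η := by
  rw [rates, exitRate, Measure.finsetSum_apply, ENNReal.ofNNReal_finsetSum]
  refine Finset.sum_congr rfl fun x _ => ?_
  simp only [Measure.add_apply, Measure.smul_apply, measure_univ, ENNReal.smul_def, smul_eq_mul,
    mul_one]
  norm_cast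
  have h : (1 / 2 : ℝ≥0) + 1 / 2 = 1 := add_halves 1
  rw [← mul_add, h, mul_one, mul_add, mul_one]

theorem exitRate_pos (r μ : ℝ≥0) {η : Config} (hη : η ≠ 0) : 0 < exitRate r μ η := by
  obtain ⟨x, hx⟩ := Finsupp.support_nonempty_iff.mpr hη
  refine Finset.sum_pos (fun y hy => ?_) ⟨x, hx⟩
  have : (0 : ℝ≥0) < η y := by
    exact_mod_cast Nat.pos_of_ne_zero (Finsupp.mem_support_iff.mp hy)
  positivity

/-- The law of the next configuration when the process jumps out of `η`. The empty configuration,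
which is never reached from a nonempty one, is absorbing. -/
noncomputable def jumpLaw (r μ : ℝ≥0) (η : Config) : Measure Config :=
  open Classical in
  if η = 0 then Measure.dirac 0 else (exitRate r μ η : ℝ≥0∞)⁻¹ • rates r μ η

instance (r μ : ℝ≥0) (η : Config) : IsProbabilityMeasure (jumpLaw r μ η) := by
  unfold jumpLaw
  split_ifs with h
  · infer_instance
  · refine ⟨?_⟩
    rw [Measure.smul_apply, rates_univ, smul_eq_mul]
    exact ENNReal.inv_mul_cancel (by exact_mod_cast (exitRate_pos r μ h).ne') ENNReal.coe_ne_top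

/-- The law of the time spent in `η` before the next jump: exponential with parameter the total
rate out of `η` (for the absorbing empty configuration the parameter is irrelevant). -/
noncomputable def holdingLaw (r μ : ℝ≥0) (η : Config) : Measure ℝ :=
  open Classical in
  expMeasure (if η = 0 then 1 else (exitRate r μ η : ℝ))

instance (r μ : ℝ≥0) (η : Config) : IsProbabilityMeasure (holdingLaw r μ η) := by
  refine isProbabilityMeasure_expMeasure ?_
  split_ifs with h
  · exact one_pos
  · exact_mod_cast exitRate_pos r μ h

/-- The jump laws as a Markov kernel: the transition kernel of the embedded jump chain. -/
noncomputable def jumpKernel (r μ : ℝ≥0) : Kernel Config Config :=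
  Kernel.ofFunOfCountable (jumpLaw r μ)

instance (r μ : ℝ≥0) : IsMarkovKernel (jumpKernel r μ) :=
  ⟨fun η => inferInstanceAs (IsProbabilityMeasure (jumpLaw r μ η))⟩

/-- The holding time laws as a Markov kernel. -/
noncomputable def holdingKernel (r μ : ℝ≥0) : Kernel Config ℝ :=
  Kernel.ofFunOfCountable (holdingLaw r μ)

instance (r μ : ℝ≥0) : IsMarkovKernel (holdingKernel r μ) :=
  ⟨fun η => inferInstanceAs (IsProbabilityMeasure (holdingLaw r μ η))⟩

/-- From the current configuration, choose the next configuration and then the time that will be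
spent in it. -/
noncomputable def stepKernel (r μ : ℝ≥0) : Kernel Config (Config × ℝ) :=
  jumpKernel r μ ⊗ₖ (holdingKernel r μ).comap Prod.snd measurable_snd

instance (r μ : ℝ≥0) : IsMarkovKernel (stepKernel r μ) := by
  unfold stepKernel; infer_instance

/-- The sample space: `(ω n).1` is the configuration after `n` transitions and `(ω n).2` is the
time spent in it. -/
abbrev Path : Type := ℕ → Config × ℝ

/-- The law of the step `n + 1` given the steps `0, …, n`; it depends only on the configuration
after `n` transitions. -/
noncomputable def transition (r μ : ℝ≥0) (n : ℕ) :
    Kernel ((_ : Finset.Iic n) → Config × ℝ) (Config × ℝ) :=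
  (stepKernel r μ).comap (fun h => (h ⟨n, Finset.mem_Iic.mpr le_rfl⟩).1) (by fun_prop)

instance (r μ : ℝ≥0) (n : ℕ) : IsMarkovKernel (transition r μ n) := by
  unfold transition; infer_instance

/-- The law of the coalescing branching random walk with branching rate `r` and coalescence rate
`μ`, started from the configuration `η₀`. -/
noncomputable def law (r μ : ℝ≥0) (η₀ : Config) : Measure Path :=
  Kernel.trajMeasure (X := fun _ => Config × ℝ) (Measure.dirac η₀ ⊗ₘ holdingKernel r μ)
    (transition r μ)

instance (r μ : ℝ≥0) (η₀ : Config) : IsProbabilityMeasure (law r μ η₀) := by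
  unfold law; infer_instance

/-- The time at which the `n`-th transition occurs (`0` for `n = 0`). -/
noncomputable def jumpTime (ω : Path) (n : ℕ) : ℝ := ∑ i ∈ Finset.range n, (ω i).2

/-- The configuration at time `t`: the `n`-th one, for the first `n` such that the `(n + 1)`-st
transition occurs after time `t`. If infinitely many transitions occurred up to time `t` (an event
of probability zero), it is the empty configuration. -/
noncomputable def configAt (t : ℝ) (ω : Path) : Config :=
  open Classical in
  if h : ∃ n, t < jumpTime ω (n + 1) then (ω (Nat.find h)).1 else 0

/-- The position of the rightmost particle at time `t` on the lattice `σℤ`; it is `⊥ = -∞` if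
there is no particle. -/
noncomputable def Xmax (σ t : ℝ) (ω : Path) : EReal :=
  (configAt t ω).support.sup fun x => ((σ * x : ℝ) : EReal)

end CBRW

/-! Let p_t(m) be the probability of a particle at or beyond site m at time t (`rightTail`). The
event of the theorem is that of p_t(⌈vt/σ⌉), and the limit exists by Fekete's lemma applied to -log
p_t(⌈vt/σ⌉), since p is supermultiplicative: p_s(m) p_t(n) ≤ p_{s+t}(m+n) (`rightTail_mul_le`). If a
particle sits at x ≥ m at time s, dropping all the others can only lower the chance of being far to
the right later, and the one kept starts a translated copy of the process. Fekete also needs -log p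
bounded on compact time intervals: forcing n jumps to the right gives p_t(m) ≥ (t/2n)^n e^{-(1+r)t}
for m ≤ n (`le_rightTail`), which also yields positivity.

Dropping particles is justified by attractiveness (`occ_mono_left`): for ζ ≤ η the two processes can
be coupled so that the order persists, because coalescence acts on pairs and the pairs of ζ are
among those of η. No coupled process is built. The law on paths enters through first-step integral
equations (`law_real_eq_of_cons`), and attractiveness, translation invariance and the Markov
inequality are proved from them by induction on the number k of transitions allowed. Letting k → ∞
requires non-explosion (`tendsto_law_jumpsBy`), which holds since the expected particle number grows
at rate at most r. -/

namespace CBRW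

/-! ### The law on paths and its decomposition at the first transition -/

/-- The path stopped after `n` transitions. -/
def stopAt (n : ℕ) (ω : Path) : Path := fun i => ω (min i n)

/-- Prepend a step to a path. -/
def cons (x : Config × ℝ) (ω : Path) : Path := fun i => Nat.casesOn i x ω

/-- Keep the path up to step `n` and continue it by the constant step `x`. -/
def extend (n : ℕ) (ω : Path) (x : Config × ℝ) : Path := fun i => if i ≤ n then ω i else x

@[simp] theorem cons_zero (x : Config × ℝ) (ω : Path) : cons x ω 0 = x := rfl
@[simp] theorem cons_succ (x : Config × ℝ) (ω : Path) (n : ℕ) : cons x ω (n + 1) = ω n := rfl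

theorem measurable_stopAt (n : ℕ) : Measurable (stopAt n) :=
  measurable_pi_lambda _ fun _ => measurable_pi_apply _

theorem measurable_cons : Measurable fun p : (Config × ℝ) × Path => cons p.1 p.2 := by
  refine measurable_pi_lambda _ fun i => ?_
  cases i with
  | zero => exact measurable_fst
  | succ n => exact (measurable_pi_apply n).comp measurable_snd

theorem measurable_extend (n : ℕ) :
    Measurable fun p : Path × (Config × ℝ) => extend n p.1 p.2 := by
  refine measurable_pi_lambda _ fun i => ?_
  unfold extend
  split_ifs
  · exact (measurable_pi_apply i).comp measurable_fst
  · exact measurable_snd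

theorem stopAt_succ (n : ℕ) (ω : Path) :
    stopAt (n + 1) ω = extend n (stopAt n ω) (ω (n + 1)) := by
  funext i
  unfold stopAt extend
  split_ifs with h
  · simp [min_eq_left h, min_eq_left (Nat.le_succ_of_le h)]
  · rw [min_eq_right (by omega)]

theorem stopAt_zero (ω : Path) : stopAt 0 ω = fun _ => ω 0 := by
  funext i; simp [stopAt]

theorem stopAt_succ_cons (n : ℕ) (x : Config × ℝ) (ω : Path) :
    stopAt (n + 1) (cons x ω) = cons x (stopAt n ω) := by
  funext i
  cases i with
  | zero => simp [stopAt]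
  | succ i => simp [stopAt, Nat.add_min_add_right]

/-- Cylinders over the coordinates up to `n` are invariant under `stopAt n`, and they form a
generating π-system. -/
theorem measure_ext_stopAt {P Q : Measure Path} [IsFiniteMeasure P]
    (h : ∀ n, P.map (stopAt n) = Q.map (stopAt n)) : P = Q := by
  have huniv : P Set.univ = Q Set.univ := by
    have := congrArg (fun m => m Set.univ) (h 0)
    simpa [Measure.map_apply (measurable_stopAt 0) MeasurableSet.univ] using this
  refine ext_of_generate_finite (measurableCylinders fun _ => Config × ℝ)
    generateFrom_measurableCylinders.symm isPiSystem_measurableCylinders ?_ huniv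
  intro s hs
  obtain ⟨n, S, hS, rfl⟩ : ∃ N S, MeasurableSet S ∧ s = cylinder (Finset.Iic N) S := by
    simpa [measurableCylinders_nat] using hs
  have hc : stopAt n ⁻¹' (cylinder (Finset.Iic n) S) = cylinder (Finset.Iic n) S := by
    ext ω
    simp only [Set.mem_preimage, mem_cylinder]
    have : (Finset.Iic n).restrict (stopAt n ω) = (Finset.Iic n).restrict ω := by
      funext i
      have := Finset.mem_Iic.mp i.2
      simp [stopAt, this]
    rw [this]
  rw [← hc, ← Measure.map_apply (measurable_stopAt n) hS.cylinder, h n,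
    Measure.map_apply (measurable_stopAt n) hS.cylinder]

variable (r μ : ℝ≥0)

/-- The Markov chain property of a law on paths, in integrated form. -/
def IsChain (P : Measure Path) : Prop :=
  ∀ n, ∀ G : Path × (Config × ℝ) → ℝ≥0∞, Measurable G →
    ∫⁻ ω, G (stopAt n ω, ω (n + 1)) ∂P
      = ∫⁻ ω, ∫⁻ x, G (stopAt n ω, x) ∂(stepKernel r μ (ω n).1) ∂P

theorem measurable_lintegral_stepKernel (n : ℕ) {G : Path × (Config × ℝ) → ℝ≥0∞}
    (hG : Measurable G) :
    Measurable fun ω : Path => ∫⁻ x, G (ω, x) ∂(stepKernel r μ (ω n).1) :=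
  Measurable.lintegral_kernel_prod_right
    (κ := (stepKernel r μ).comap (fun ω : Path => (ω n).1) (by fun_prop)) hG

/-- By induction on `n`, the law of the path stopped at `n + 1` is determined by that of the path
stopped at `n` and the step kernel. -/
theorem IsChain.ext {P Q : Measure Path} [IsFiniteMeasure P] (hP : IsChain r μ P)
    (hQ : IsChain r μ Q) (h0 : P.map (fun ω => ω 0) = Q.map (fun ω => ω 0)) : P = Q := by
  refine measure_ext_stopAt fun n => ?_
  induction n with
  | zero =>
    have e : stopAt 0 = (fun x : Config × ℝ => (fun _ => x : Path)) ∘ fun ω => ω 0 := by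
      funext ω; exact stopAt_zero ω
    have hm : Measurable fun x : Config × ℝ => (fun _ => x : Path) := by fun_prop
    rw [e, ← Measure.map_map hm (by fun_prop), ← Measure.map_map hm (by fun_prop), h0]
  | succ n ih =>
    have key : ∀ R : Measure Path, IsChain r μ R → ∀ F : Path → ℝ≥0∞, Measurable F →
        ∫⁻ ω, F ω ∂(R.map (stopAt (n + 1)))
          = ∫⁻ ω, ∫⁻ x, F (extend n ω x) ∂(stepKernel r μ (ω n).1) ∂(R.map (stopAt n)) := by
      intro R hR F hF
      have hG : Measurable fun p : Path × (Config × ℝ) => F (extend n p.1 p.2) :=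
        hF.comp (measurable_extend n)
      rw [lintegral_map hF (measurable_stopAt _),
        lintegral_map (measurable_lintegral_stepKernel r μ n hG) (measurable_stopAt _)]
      simp_rw [stopAt_succ]
      rw [hR n _ hG]
      simp [stopAt]
    refine Measure.ext_of_lintegral _ fun F hF => ?_
    rw [key P hP F hF, key Q hQ F hF, ih]

theorem isChain_law (η : Config) : IsChain r μ (law r μ η) := by
  intro n G hG
  have h := Kernel.map_frestrictLe_trajMeasure_compProd_eq_map_trajMeasure
    (X := fun _ => Config × ℝ) (μ₀ := Measure.dirac η ⊗ₘ holdingKernel r μ)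
    (κ := transition r μ) (a := n)
  change (law r μ η).map _ ⊗ₘ _ = (law r μ η).map _ at h
  -- Histories of length `n` are embedded as paths that are constant after `n`, so that `stopAt n`
  -- factors through the restriction.
  let E : ((_ : Finset.Iic n) → Config × ℝ) → Path := fun f i =>
    f ⟨min i n, Finset.mem_Iic.mpr (min_le_right _ _)⟩
  have hE : Measurable E := measurable_pi_lambda _ fun _ => measurable_pi_apply _
  have hEr : ∀ ω : Path, E (Preorder.frestrictLe n ω) = stopAt n ω := fun ω => rfl
  have hG' : Measurable fun p : ((_ : Finset.Iic n) → Config × ℝ) × (Config × ℝ) =>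
      G (E p.1, p.2) := hG.comp ((hE.comp measurable_fst).prodMk measurable_snd)
  have h2 := congrArg (fun m => ∫⁻ p, G (E p.1, p.2) ∂m) h
  rw [Measure.lintegral_compProd hG', lintegral_map hG' (by fun_prop), lintegral_map] at h2
  · simp only [hEr] at h2
    rw [← h2]
    rfl
  · exact hG'.lintegral_kernel_prod_right'
  · fun_prop

theorem law_map_zero (η : Config) :
    (law r μ η).map (fun ω => ω 0) = Measure.dirac η ⊗ₘ holdingKernel r μ := by
  have : (fun ω : Path => ω 0) = (fun f : (_ : Finset.Iic 0) → Config × ℝ =>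
      f ⟨0, Finset.mem_Iic.mpr le_rfl⟩) ∘ Preorder.frestrictLe 0 := rfl
  rw [this, ← Measure.map_map (by fun_prop) (by fun_prop), law, Kernel.trajMeasure,
    Measure.map_comp _ _ (by fun_prop), Kernel.traj_map_frestrictLe, Kernel.partialTraj_self,
    Measure.id_comp, Measure.map_map (by fun_prop) (by fun_prop)]
  convert! Measure.map_id

/-- The laws of the process as a kernel in the initial configuration. -/
noncomputable def lawKernel : Kernel Config Path := Kernel.ofFunOfCountable (law r μ)

instance : IsMarkovKernel (lawKernel r μ) :=
  ⟨fun η => inferInstanceAs (IsProbabilityMeasure (law r μ η))⟩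

/-- The law of the process described by its first holding time and the process after the first
transition. -/
noncomputable def firstStep (η : Config) : Measure Path :=
  ((holdingLaw r μ η).prod (lawKernel r μ ∘ₘ jumpLaw r μ η)).map
    fun p : ℝ × Path => cons (η, p.1) p.2

theorem measurable_cons_prodMk (η : Config) :
    Measurable fun p : ℝ × Path => cons (η, p.1) p.2 :=
  measurable_cons.comp (by fun_prop : Measurable fun p : ℝ × Path => ((η, p.1), p.2))

instance (η : Config) : IsProbabilityMeasure (firstStep r μ η) :=
  Measure.isProbabilityMeasure_map (measurable_cons_prodMk η).aemeasurable

theorem lintegral_firstStep (η : Config) {F : Path → ℝ≥0∞} (hF : Measurable F) :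
    ∫⁻ ω, F ω ∂(firstStep r μ η) = ∫⁻ s, ∫⁻ ζ, ∫⁻ ω, F (cons (η, s) ω) ∂(law r μ ζ)
      ∂(jumpLaw r μ η) ∂(holdingLaw r μ η) := by
  have hc : Measurable fun p : ℝ × Path => F (cons (η, p.1) p.2) :=
    hF.comp (measurable_cons_prodMk η)
  rw [firstStep, lintegral_map hF (measurable_cons_prodMk η),
    lintegral_prod _ hc.aemeasurable]
  refine lintegral_congr fun s => ?_
  rw [Measure.lintegral_bind (Kernel.aemeasurable _)]
  · rfl
  · exact (hc.comp measurable_prodMk_left).aemeasurable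

theorem lintegral_stepKernel (η : Config) {F : Config × ℝ → ℝ≥0∞} (hF : Measurable F) :
    ∫⁻ x, F x ∂(stepKernel r μ η)
      = ∫⁻ ζ, ∫⁻ s, F (ζ, s) ∂(holdingLaw r μ ζ) ∂(jumpLaw r μ η) := by
  rw [stepKernel, Kernel.lintegral_compProd _ _ _ hF]
  rfl

theorem lintegral_law_zero (η : Config) {F : Config × ℝ → ℝ≥0∞} (hF : Measurable F) :
    ∫⁻ ω, F (ω 0) ∂(law r μ η) = ∫⁻ s, F (η, s) ∂(holdingLaw r μ η) := by
  rw [← lintegral_map (f := F) (g := fun ω : Path => ω 0) hF (by fun_prop), law_map_zero,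
    Measure.lintegral_compProd hF, lintegral_dirac]
  rfl

/-- The first transition draws ζ from `jumpLaw` and then the initial holding time of `law r μ ζ`,
which is exactly one `stepKernel`; later transitions are those of `law r μ ζ` with indices moved by
one. -/
theorem isChain_firstStep (η : Config) : IsChain r μ (firstStep r μ η) := by
  intro n G hG
  have h1 : ∀ n, Measurable fun ω : Path => G (stopAt n ω, ω (n + 1)) := fun n =>
    hG.comp ((measurable_stopAt n).prodMk (measurable_pi_apply _))
  have h2 : ∀ n, Measurable fun ω : Path =>
      ∫⁻ x, G (stopAt n ω, x) ∂(stepKernel r μ (ω n).1) := fun n => by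
    have := (measurable_lintegral_stepKernel r μ n hG).comp (measurable_stopAt n)
    simpa [Function.comp_def, stopAt] using this
  rw [lintegral_firstStep r μ η (h1 n), lintegral_firstStep r μ η (h2 n)]
  refine lintegral_congr fun s => ?_
  cases n with
  | zero =>
    simp only [stopAt_zero, cons_zero, cons_succ, zero_add, lintegral_const, measure_univ,
      mul_one]
    have hG0 : Measurable fun x => G (fun _ => (η, s), x) := hG.comp measurable_prodMk_left
    rw [lintegral_stepKernel r μ η hG0]
    exact lintegral_congr fun ζ => lintegral_law_zero r μ ζ hG0
  | succ n =>
    refine lintegral_congr fun ζ => ?_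
    simp only [stopAt_succ_cons, cons_succ]
    have hG' : Measurable fun p : Path × (Config × ℝ) => G (cons (η, s) p.1, p.2) :=
      hG.comp ((measurable_cons.comp (measurable_const.prodMk measurable_fst)).prodMk
        measurable_snd)
    exact isChain_law r μ ζ n _ hG'

theorem law_eq_firstStep (η : Config) : law r μ η = firstStep r μ η := by
  refine IsChain.ext r μ (isChain_law r μ η) (isChain_firstStep r μ η) ?_
  refine Measure.ext_of_lintegral _ fun F hF => ?_
  rw [lintegral_map hF (by fun_prop), lintegral_map hF (by fun_prop),
    lintegral_law_zero r μ η hF,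
    lintegral_firstStep r μ η (F := fun ω => F (ω 0)) (hF.comp (measurable_pi_apply 0))]
  simp

theorem lintegral_law (η : Config) {F : Path → ℝ≥0∞} (hF : Measurable F) :
    ∫⁻ ω, F ω ∂(law r μ η) = ∫⁻ s, ∫⁻ ζ, ∫⁻ ω, F (cons (η, s) ω) ∂(law r μ ζ)
      ∂(jumpLaw r μ η) ∂(holdingLaw r μ η) := by
  conv_lhs => rw [law_eq_firstStep]
  exact lintegral_firstStep r μ η hF

end CBRW

/-! ### First-step equations for events at a fixed time -/

namespace CBRW

theorem jumpTime_cons_succ (η : Config) (s : ℝ) (ω : Path) (n : ℕ) :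
    jumpTime (cons (η, s) ω) (n + 1) = s + jumpTime ω n := by
  simp [jumpTime, Finset.sum_range_succ', add_comm]

theorem configAt_cons (t : ℝ) (η : Config) (s : ℝ) (ω : Path) :
    configAt t (cons (η, s) ω) = if t < s then η else configAt (t - s) ω := by
  classical
  have h0 : jumpTime ω 0 = 0 := by simp [jumpTime]
  unfold configAt
  simp only [jumpTime_cons_succ, sub_lt_iff_lt_add']
  by_cases hts : t < s
  · have hex : ∃ n, t < s + jumpTime ω n := ⟨0, by simpa [h0] using hts⟩
    have : Nat.find hex = 0 := by rw [Nat.find_eq_zero]; simpa [h0] using hts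
    rw [dif_pos hex, if_pos hts, this]
    rfl
  · rw [if_neg hts]
    have hn0 : ¬ t < s + jumpTime ω 0 := by simpa [h0] using hts
    by_cases hex : ∃ n, t < s + jumpTime ω (n + 1)
    · have hex' : ∃ n, t < s + jumpTime ω n := ⟨_, hex.choose_spec⟩
      -- Index 0 is excluded by `hn0`, so prepending a step moves the first index by exactly one.
      rw [dif_pos hex, dif_pos hex', Nat.find_comp_succ hex' hex hn0]
      rfl
    · have hex' : ¬ ∃ n, t < s + jumpTime ω n := by
        rintro ⟨n, hn⟩
        cases n with
        | zero => exact hn0 hn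
        | succ n => exact hex ⟨n, hn⟩
      rw [dif_neg hex, dif_neg hex']

theorem measurable_jumpTime (n : ℕ) : Measurable fun ω : Path => jumpTime ω n := by
  unfold jumpTime
  exact Finset.measurable_sum _ fun i _ => measurable_snd.comp (measurable_pi_apply i)

theorem measurableSet_lt_jumpTime (n : ℕ) :
    MeasurableSet {p : ℝ × Path | p.1 < jumpTime p.2 n} :=
  measurableSet_lt measurable_fst ((measurable_jumpTime n).comp measurable_snd)

theorem measurableSet_configAt (B : Set Config) :
    MeasurableSet {p : ℝ × Path | configAt p.1 p.2 ∈ B} := by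
  classical
  have hB : ∀ n, MeasurableSet {p : ℝ × Path | (p.2 n).1 ∈ B} := fun n =>
    (measurable_fst.comp ((measurable_pi_apply n).comp measurable_snd)
      : Measurable fun p : ℝ × Path => (p.2 n).1) (MeasurableSet.of_discrete (s := B))
  have hL := fun n => measurableSet_lt_jumpTime (n + 1)
  have : {p : ℝ × Path | configAt p.1 p.2 ∈ B} =
      (⋃ n, ({p : ℝ × Path | p.1 < jumpTime p.2 (n + 1)} ∩
        (⋂ m, ⋂ (_ : m < n), {p : ℝ × Path | p.1 < jumpTime p.2 (m + 1)}ᶜ)) ∩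
          {p : ℝ × Path | (p.2 n).1 ∈ B}) ∪
      ((⋂ n, {p : ℝ × Path | p.1 < jumpTime p.2 (n + 1)}ᶜ) ∩ {_p | (0 : Config) ∈ B}) := by
    ext ⟨t, ω⟩
    simp only [configAt, Set.mem_ofPred_eq, Set.mem_union, Set.mem_iUnion, Set.mem_inter_iff,
      Set.mem_iInter, Set.mem_compl_iff]
    by_cases h : ∃ n, t < jumpTime ω (n + 1)
    · rw [dif_pos h]
      constructor
      · intro hb
        exact Or.inl ⟨Nat.find h, ⟨Nat.find_spec h, fun m hm => Nat.find_min h hm⟩, hb⟩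
      · rintro (⟨n, ⟨h1, h2⟩, h3⟩ | ⟨h1, -⟩)
        · rwa [(Nat.find_eq_iff h).mpr ⟨h1, h2⟩]
        · exact absurd h.choose_spec (h1 _)
    · rw [dif_neg h]
      push Not at h
      constructor
      · intro hb
        exact Or.inr ⟨fun n => not_lt.mpr (h n), hb⟩
      · rintro (⟨n, ⟨h1, h2⟩, h3⟩ | ⟨-, h1⟩)
        · exact absurd h1 (not_lt.mpr (h n))
        · exact h1
  rw [this]
  refine MeasurableSet.union (MeasurableSet.iUnion fun n => ((hL n).inter ?_).inter (hB n))
    ((MeasurableSet.iInter fun n => (hL n).compl).inter (MeasurableSet.const _))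
  exact MeasurableSet.iInter fun m => MeasurableSet.iInter fun _ => (hL m).compl

/-- The configuration at time `t` belongs to `B`. -/
def visits (B : Set Config) (t : ℝ) : Set Path := {ω | configAt t ω ∈ B}

/-- The configuration at time `t` belongs to `B`, and is reached after fewer than `k`
transitions. -/
def visitsWithin (B : Set Config) (k : ℕ) (t : ℝ) : Set Path :=
  {ω | configAt t ω ∈ B ∧ ∃ n < k, t < jumpTime ω (n + 1)}

theorem measurableSet_visits (B : Set Config) :
    MeasurableSet {p : ℝ × Path | p.2 ∈ visits B p.1} := measurableSet_configAt B

theorem measurableSet_visitsWithin (B : Set Config) (k : ℕ) :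
    MeasurableSet {p : ℝ × Path | p.2 ∈ visitsWithin B k p.1} := by
  refine (measurableSet_configAt B).inter ?_
  have : {p : ℝ × Path | ∃ n < k, p.1 < jumpTime p.2 (n + 1)} =
      ⋃ n, ⋃ (_ : n < k), {p : ℝ × Path | p.1 < jumpTime p.2 (n + 1)} := by
    ext p; simp
  change MeasurableSet {p : ℝ × Path | ∃ n < k, p.1 < jumpTime p.2 (n + 1)}
  rw [this]
  exact MeasurableSet.iUnion fun n => MeasurableSet.iUnion fun _ =>
    measurableSet_lt_jumpTime (n + 1)

theorem measurableSet_section {E : ℝ → Set Path}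
    (hE : MeasurableSet {p : ℝ × Path | p.2 ∈ E p.1}) (t : ℝ) : MeasurableSet (E t) :=
  measurable_prodMk_left (x := t) hE

theorem cons_mem_visits (B : Set Config) (t : ℝ) (η : Config) (s : ℝ) (ω : Path) :
    cons (η, s) ω ∈ visits B t ↔ if t < s then η ∈ B else ω ∈ visits B (t - s) := by
  simp only [visits, Set.mem_ofPred_eq, configAt_cons]
  split_ifs <;> rfl

theorem cons_mem_visitsWithin (B : Set Config) (k : ℕ) (t : ℝ) (η : Config) (s : ℝ)
    (ω : Path) : cons (η, s) ω ∈ visitsWithin B (k + 1) t ↔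
      if t < s then η ∈ B else ω ∈ visitsWithin B k (t - s) := by
  have h0 : jumpTime ω 0 = 0 := by simp [jumpTime]
  simp only [visitsWithin, Set.mem_ofPred_eq, configAt_cons, jumpTime_cons_succ,
    sub_lt_iff_lt_add']
  split_ifs with h
  · refine and_iff_left ⟨0, Nat.succ_pos k, by simpa [h0] using h⟩
  · refine and_congr_right fun _ => ⟨?_, ?_⟩
    · rintro ⟨n, hn, hlt⟩
      cases n with
      | zero => exact absurd (by simpa [h0] using hlt) h
      | succ n => exact ⟨n, by omega, hlt⟩
    · rintro ⟨n, hn, hlt⟩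
      exact ⟨n + 1, by omega, hlt⟩

/-- The integral of a function against the rates out of a configuration. -/
noncomputable def ratesSum (r μ : ℝ≥0) (f : Config → ℝ) (η : Config) : ℝ :=
  ∑ x ∈ η.support,
    ((η x : ℝ) * (1 / 2) * f (η - single x + single (x + 1))
      + (η x : ℝ) * (1 / 2) * f (η - single x + single (x - 1))
      + (η x : ℝ) * r * f (η + single x)
      + ((η x).choose 2 : ℝ) * μ * f (η - single x))

variable (r μ : ℝ≥0)

theorem integrable_dirac_config (f : Config → ℝ) (η : Config) :
    Integrable f (Measure.dirac η) := integrable_dirac (by simp)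

theorem integral_jumpLaw {η : Config} (hη : η ≠ 0) (f : Config → ℝ) :
    ∫ ζ, f ζ ∂(jumpLaw r μ η) = (exitRate r μ η : ℝ)⁻¹ * ratesSum r μ f η := by
  have hd : ∀ (c : ℝ≥0) ζ, Integrable f (c • Measure.dirac ζ) := fun c ζ =>
    (integrable_dirac_config f ζ).smul_measure_nnreal
  have hi : ∀ (c : ℝ≥0) ζ, ∫ ξ, f ξ ∂(c • Measure.dirac ζ) = c * f ζ := fun c ζ => by
    rw [integral_smul_nnreal_measure, integral_dirac, NNReal.smul_def, smul_eq_mul]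
  rw [jumpLaw, if_neg hη, integral_smul_measure, ENNReal.toReal_inv, ENNReal.coe_toReal,
    smul_eq_mul]
  congr 1
  rw [rates, ratesSum, integral_finsetSum_measure]
  · refine Finset.sum_congr rfl fun x _ => ?_
    rw [integral_add_measure (((hd _ _).add_measure (hd _ _)).add_measure (hd _ _)) (hd _ _),
      integral_add_measure ((hd _ _).add_measure (hd _ _)) (hd _ _),
      integral_add_measure (hd _ _) (hd _ _), hi, hi, hi, hi]
    push_cast
    ring
  · intro x _
    exact (((hd _ _).add_measure (hd _ _)).add_measure (hd _ _)).add_measure (hd _ _)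

theorem ratesSum_one (η : Config) : ratesSum r μ (fun _ => 1) η = exitRate r μ η := by
  rw [ratesSum, exitRate]
  push_cast
  exact Finset.sum_congr rfl fun x _ => by ring

theorem ratesSum_mono {f g : Config → ℝ} (h : ∀ ζ, f ζ ≤ g ζ) (η : Config) :
    ratesSum r μ f η ≤ ratesSum r μ g η := by
  refine Finset.sum_le_sum fun x _ => ?_
  gcongr <;> apply h

theorem ratesSum_add (f g : Config → ℝ) (η : Config) :
    ratesSum r μ (fun ζ => f ζ + g ζ) η = ratesSum r μ f η + ratesSum r μ g η := by
  simp only [ratesSum, ← Finset.sum_add_distrib]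
  exact Finset.sum_congr rfl fun x _ => by ring

theorem ratesSum_const_mul (c : ℝ) (f : Config → ℝ) (η : Config) :
    ratesSum r μ (fun ζ => c * f ζ) η = c * ratesSum r μ f η := by
  simp only [ratesSum, Finset.mul_sum]
  exact Finset.sum_congr rfl fun x _ => by ring

theorem measurable_ratesSum {f : ℝ → Config → ℝ} (hf : ∀ ζ, Measurable fun t => f t ζ)
    (η : Config) : Measurable fun t => ratesSum r μ (f t) η := by
  unfold ratesSum
  refine Finset.measurable_sum _ fun x _ => ?_
  have := hf
  fun_prop

theorem continuous_ratesSum {X : Type*} [TopologicalSpace X] {f : X → Config → ℝ}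
    (hf : ∀ ζ, Continuous fun t => f t ζ) (η : Config) :
    Continuous fun t => ratesSum r μ (f t) η := by
  unfold ratesSum
  have := hf
  fun_prop

theorem ratesSum_nonneg {f : Config → ℝ} (h : ∀ ζ, 0 ≤ f ζ) (η : Config) :
    0 ≤ ratesSum r μ f η := by
  unfold ratesSum
  exact Finset.sum_nonneg fun x _ => add_nonneg (add_nonneg (add_nonneg
    (mul_nonneg (by positivity) (h _)) (mul_nonneg (by positivity) (h _)))
    (mul_nonneg (by positivity) (h _))) (mul_nonneg (by positivity) (h _))

theorem abs_ratesSum_le {f : Config → ℝ} (h0 : ∀ ζ, 0 ≤ f ζ) (h1 : ∀ ζ, f ζ ≤ 1)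
    (η : Config) : |ratesSum r μ f η| ≤ exitRate r μ η := by
  rw [abs_of_nonneg (ratesSum_nonneg r μ h0 η), ← ratesSum_one]
  exact ratesSum_mono r μ h1 η

theorem measurable_law_real {E : ℝ → Set Path}
    (hE : MeasurableSet {p : ℝ × Path | p.2 ∈ E p.1}) (η : Config) :
    Measurable fun t => (law r μ η).real (E t) :=
  (measurable_measure_prodMk_left hE).ennreal_toReal

theorem integral_expMeasure {l : ℝ} (hl : 0 < l) (g : ℝ → ℝ) :
    ∫ s, g s ∂(expMeasure l) = ∫ s in Set.Ioi 0, l * Real.exp (-(l * s)) * g s := by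
  have : expMeasure l = volume.withDensity fun s => exponentialPDF l s := rfl
  have hm : Measurable (exponentialPDFReal l) := measurable_exponentialPDFReal l
  rw [this, integral_withDensity_eq_integral_toReal_smul₀
    (by exact hm.ennreal_ofReal.aemeasurable)
    (by filter_upwards with s using ENNReal.ofReal_lt_top)]
  rw [← integral_Ici_eq_integral_Ioi, ← integral_indicator measurableSet_Ici]
  refine integral_congr_ae (Eventually.of_forall fun s => ?_)
  by_cases hs : 0 ≤ s
  · simp only [exponentialPDF_eq, hs, if_true, smul_eq_mul, Set.indicator, Set.mem_Ici]
    rw [ENNReal.toReal_ofReal (by positivity)]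
  · simp [exponentialPDF_eq, hs, Set.indicator]

theorem integral_expMeasure_split {l : ℝ} (hl : 0 < l) {t : ℝ} (ht : 0 ≤ t) (b : ℝ)
    {g : ℝ → ℝ} (hg : IntervalIntegrable (fun s => l * Real.exp (-(l * s)) * g s) volume 0 t) :
    ∫ s, (if t < s then b else g s) ∂(expMeasure l)
      = Real.exp (-(l * t)) * b + ∫ s in (0 : ℝ)..t, l * Real.exp (-(l * s)) * g s := by
  have hexp : IntegrableOn (fun s => l * Real.exp (-(l * s)) * b) (Set.Ioi t) := by
    have := (integrableOn_exp_mul_Ioi (a := -l) (by linarith) t).const_mul l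
    have := this.mul_const b
    refine this.congr (Eventually.of_forall fun s => ?_)
    simp [neg_mul]
  rw [integral_expMeasure hl, ← Set.Ioc_union_Ioi_eq_Ioi ht, setIntegral_union
    (Set.Ioc_disjoint_Ioi le_rfl) measurableSet_Ioi, add_comm,
    intervalIntegral.integral_of_le ht]
  · congr 1
    · have : ∫ s in Set.Ioi t, l * Real.exp (-(l * s)) * (if t < s then b else g s)
          = ∫ s in Set.Ioi t, l * b * Real.exp ((-l) * s) := by
        refine setIntegral_congr_fun measurableSet_Ioi fun s hs => ?_
        simp only [Set.mem_Ioi] at hs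
        simp only [hs, if_true, neg_mul]
        ring
      rw [this, integral_const_mul, integral_exp_mul_Ioi (by linarith)]
      rw [neg_mul]
      field_simp
    · refine setIntegral_congr_fun measurableSet_Ioc fun s hs => ?_
      simp [not_lt.mpr hs.2]
  · rw [intervalIntegrable_iff_integrableOn_Ioc_of_le ht] at hg
    refine hg.congr_fun (fun s hs => ?_) measurableSet_Ioc
    simp [not_lt.mpr hs.2]
  · refine hexp.congr_fun (fun s hs => ?_) measurableSet_Ioi
    simp only [Set.mem_Ioi] at hs
    simp [hs]

open Classical in
/-- First step analysis, for events determined by the first step before it occurs. -/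
theorem law_real_eq_of_cons {η : Config} (hη : η ≠ 0) (B : Set Config) {E E' : ℝ → Set Path}
    (hE : MeasurableSet {p : ℝ × Path | p.2 ∈ E p.1})
    (hE' : MeasurableSet {p : ℝ × Path | p.2 ∈ E' p.1})
    (h : ∀ t η s ω, cons (η, s) ω ∈ E t ↔ if t < s then η ∈ B else ω ∈ E' (t - s))
    {t : ℝ} (ht : 0 ≤ t) :
    (law r μ η).real (E t) =
      Real.exp (-(exitRate r μ η * t)) * B.indicator 1 η
        + ∫ s in (0 : ℝ)..t, Real.exp (-(exitRate r μ η * (t - s))) *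
            ratesSum r μ (fun ζ => (law r μ ζ).real (E' s)) η := by
  have hl : (0 : ℝ) < exitRate r μ η := exitRate_pos r μ hη
  have hm : Measurable fun s => ratesSum r μ (fun ζ => (law r μ ζ).real (E' s)) η :=
    measurable_ratesSum r μ (fun ζ => measurable_law_real r μ hE' ζ) η
  have hb : ∀ s, |ratesSum r μ (fun ζ => (law r μ ζ).real (E' s)) η| ≤ exitRate r μ η :=
    fun s => abs_ratesSum_le r μ (fun _ => measureReal_nonneg) (fun _ => measureReal_le_one) η
  set l : ℝ := (exitRate r μ η : ℝ) with hldef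
  -- The conditional probability given that the first transition occurs at time `s ≤ t`.
  set g : ℝ → ℝ := fun s => l⁻¹ * ratesSum r μ (fun ζ => (law r μ ζ).real (E' (t - s))) η
    with hg
  have hgm : Measurable g := (hm.comp (measurable_const.sub measurable_id)).const_mul _
  have hg01 : ∀ s, |g s| ≤ 1 := fun s => by
    rw [hg, abs_mul, abs_of_pos (inv_pos.mpr hl)]
    calc l⁻¹ * _ ≤ l⁻¹ * l := by gcongr; exact hb _
      _ = 1 := inv_mul_cancel₀ hl.ne'
  have hprob : IsProbabilityMeasure (expMeasure l) := isProbabilityMeasure_expMeasure hl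
  have hgi : IntervalIntegrable (fun s => l * Real.exp (-(l * s)) * g s) volume 0 t := by
    have hc : IntervalIntegrable (fun s => l * Real.exp (-(l * s))) volume 0 t := by
      apply Continuous.intervalIntegrable; fun_prop
    rw [intervalIntegrable_iff] at hc ⊢
    exact hc.mul_bdd hgm.aestronglyMeasurable (c := 1) (Eventually.of_forall fun s => hg01 s)
  have e1 : (law r μ η).real (E t)
      = ∫ s, (if t < s then B.indicator 1 η else g s) ∂(expMeasure l) := by
    rw [measureReal_def, ← lintegral_indicator_one (measurableSet_section hE t),
      lintegral_law r μ η (measurable_one.indicator (measurableSet_section hE t)),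
      integral_eq_lintegral_of_nonneg_ae]
    · have : holdingLaw r μ η = expMeasure l := by rw [holdingLaw, if_neg hη]
      rw [this]
      congr 1
      refine lintegral_congr fun s => ?_
      by_cases hts : t < s
      · simp only [Set.indicator, h, if_pos hts]
        by_cases hB : η ∈ B <;> simp [hB]
      · have e2 : ∀ ζ, ∫⁻ ω, (E t).indicator 1 (cons (η, s) ω) ∂(law r μ ζ)
            = ENNReal.ofReal ((law r μ ζ).real (E' (t - s))) := fun ζ => by
          rw [ofReal_measureReal, ← lintegral_indicator_one (measurableSet_section hE' _)]
          refine lintegral_congr fun ω => ?_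
          simp only [Set.indicator, h, if_neg hts, Pi.one_apply]
        simp only [e2]
        rw [if_neg hts, hg]
        simp only
        rw [← integral_jumpLaw r μ hη, ofReal_integral_eq_lintegral_ofReal]
        · exact Integrable.of_bound (C := 1) (by fun_prop)
            (Eventually.of_forall fun ζ => by
              rw [Real.norm_of_nonneg measureReal_nonneg]; exact measureReal_le_one)
        · exact Eventually.of_forall fun ζ => measureReal_nonneg
    · refine Eventually.of_forall fun s => ?_
      simp only [Pi.zero_apply]
      split_ifs
      · exact Set.indicator_nonneg (by simp) _
      · exact mul_nonneg (inv_pos.mpr hl).le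
          (ratesSum_nonneg r μ (fun _ => measureReal_nonneg) η)
    · exact (Measurable.ite measurableSet_Ioi measurable_const hgm).aestronglyMeasurable
  rw [e1, integral_expMeasure_split hl ht _ hgi]
  congr 1
  -- Reversal of time: the integration variable becomes the time remaining after the first
  -- transition, and the density's factor `l` cancels `l⁻¹`.
  have hsub := intervalIntegral.integral_comp_sub_left (a := 0) (b := t)
    (fun s => Real.exp (-(l * (t - s))) * ratesSum r μ (fun ζ => (law r μ ζ).real (E' s)) η) t
  rw [sub_self, sub_zero] at hsub
  rw [← hsub]
  refine intervalIntegral.integral_congr fun s _ => ?_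
  simp only [hg, sub_sub_cancel]
  field_simp

end CBRW

/-! ### Non-explosion -/

namespace CBRW

variable (r μ : ℝ≥0)

theorem single_ne_zero (x : ℤ) : single x ≠ 0 := by simp [single]

theorem add_single_ne_zero (η : Config) (x : ℤ) : η + single x ≠ 0 := fun h => by
  have := DFunLike.congr_fun h x
  simp [single] at this

theorem sub_single_ne_zero {η : Config} {x : ℤ} (h : 2 ≤ η x) : η - single x ≠ 0 := fun h0 => by
  have := DFunLike.congr_fun h0 x
  simp [single] at this
  omega

/-- The rates out of a configuration only charge nonempty configurations. -/
theorem ratesSum_le_of_ne_zero {f g : Config → ℝ} (h : ∀ ζ, ζ ≠ 0 → f ζ ≤ g ζ) (η : Config) :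
    ratesSum r μ f η ≤ ratesSum r μ g η := by
  refine Finset.sum_le_sum fun x _ => ?_
  refine add_le_add (add_le_add (add_le_add ?_ ?_) ?_) ?_
  · exact mul_le_mul_of_nonneg_left (h _ (add_single_ne_zero _ _)) (by positivity)
  · exact mul_le_mul_of_nonneg_left (h _ (add_single_ne_zero _ _)) (by positivity)
  · exact mul_le_mul_of_nonneg_left (h _ (add_single_ne_zero _ _)) (by positivity)
  -- Removing the only particle would give the empty configuration, but then the binomial
  -- coefficient vanishes.
  · rcases lt_or_ge (η x) 2 with hx | hx
    · simp [Nat.choose_eq_zero_of_lt hx]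
    · exact mul_le_mul_of_nonneg_left (h _ (sub_single_ne_zero hx)) (by positivity)

theorem ratesSum_congr {f g : Config → ℝ} (h : ∀ ζ, ζ ≠ 0 → f ζ = g ζ) (η : Config) :
    ratesSum r μ f η = ratesSum r μ g η :=
  le_antisymm (ratesSum_le_of_ne_zero r μ (fun ζ hζ => (h ζ hζ).le) η)
    (ratesSum_le_of_ne_zero r μ (fun ζ hζ => (h ζ hζ).ge) η)

theorem single_le {η : Config} {x : ℤ} (hx : x ∈ η.support) : single x ≤ η := by
  rw [single, Finsupp.single_le_iff]
  exact Nat.one_le_iff_ne_zero.mpr (Finsupp.mem_support_iff.mp hx)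

theorem degree_single (x : ℤ) : (single x).degree = 1 := by simp [single]

theorem degree_sub_single {η : Config} {x : ℤ} (hx : x ∈ η.support) :
    (η - single x).degree + 1 = η.degree := by
  rw [← degree_single x, ← map_add, tsub_add_cancel_of_le (single_le hx)]

theorem degree_eq_sum (η : Config) : (η.degree : ℝ) = ∑ x ∈ η.support, (η x : ℝ) := by
  rw [Finsupp.degree_apply]; push_cast; rfl

/-- Jumps keep the particle number, branching adds one at total rate `r * η.degree`, and coalescence
only removes: the generator applied to the degree is at most `r` times the degree. -/
theorem ratesSum_degree_le (η : Config) :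
    ratesSum r μ (fun ζ => (ζ.degree : ℝ)) η ≤ (exitRate r μ η + r) * η.degree := by
  have hsum : ((exitRate r μ η : ℝ) + r) * η.degree
      = ∑ x ∈ η.support, (((η x : ℝ) * (1 + r) + ((η x).choose 2 : ℝ) * μ) * η.degree
        + r * η x) := by
    rw [Finset.sum_add_distrib, ← Finset.mul_sum, ← degree_eq_sum, ← Finset.sum_mul, add_mul,
      exitRate]
    push_cast
    rfl
  rw [hsum]
  refine Finset.sum_le_sum fun x hx => ?_
  have h1 := degree_sub_single hx
  have h2 : ((η - single x).degree : ℝ) + 1 = η.degree := by exact_mod_cast h1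
  simp only [map_add, degree_single, Nat.cast_add, Nat.cast_one]
  rw [← h2]
  have : 0 ≤ ((η x).choose 2 : ℝ) * μ := by positivity
  nlinarith

theorem exitRate_le_degree (η : Config) :
    (exitRate r μ η : ℝ) ≤ η.degree * (1 + r) + (η.degree : ℝ) ^ 2 * μ := by
  have h1 : (exitRate r μ η : ℝ) ≤ ∑ x ∈ η.support, (η x : ℝ) * ((1 + r) + η.degree * μ) := by
    rw [exitRate]
    push_cast
    refine Finset.sum_le_sum fun x hx => ?_
    have hle : (η x : ℝ) ≤ η.degree := by
      rw [degree_eq_sum]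
      exact Finset.single_le_sum (f := fun y => (η y : ℝ)) (fun _ _ => Nat.cast_nonneg _) hx
    have hc : ((η x).choose 2 : ℝ) ≤ (η x : ℝ) * η.degree :=
      calc ((η x).choose 2 : ℝ) ≤ (η x : ℝ) ^ 2 := by exact_mod_cast Nat.choose_le_pow _ _
        _ = (η x : ℝ) * η x := sq _
        _ ≤ _ := by gcongr
    have := mul_le_mul_of_nonneg_right hc μ.2
    simp only [NNReal.val_eq_coe] at this
    linarith
  rw [← Finset.sum_mul, ← degree_eq_sum] at h1
  linarith

/-- At least `k` transitions have occurred up to time `t`. -/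
def jumpsBy (k : ℕ) (t : ℝ) : Set Path := {ω | ∀ n < k, jumpTime ω (n + 1) ≤ t}

/-- The membership in `∅` gives the recursion the shape that `law_real_eq_of_cons` expects. -/
theorem cons_mem_jumpsBy (k : ℕ) (t : ℝ) (η : Config) (s : ℝ) (ω : Path) :
    cons (η, s) ω ∈ jumpsBy (k + 1) t ↔
      if t < s then η ∈ (∅ : Set Config) else ω ∈ jumpsBy k (t - s) := by
  have h0 : jumpTime ω 0 = 0 := by simp [jumpTime]
  simp only [jumpsBy, Set.mem_ofPred_eq, jumpTime_cons_succ, le_sub_iff_add_le']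
  split_ifs with h
  · simp only [Set.mem_empty_iff_false, iff_false, not_forall]
    exact ⟨0, Nat.succ_pos k, by simpa [h0] using h⟩
  · constructor
    · intro H n hn
      exact H (n + 1) (by omega)
    · intro H n hn
      cases n with
      | zero => simpa [h0] using h
      | succ n => exact H n (by omega)

theorem measurableSet_jumpsBy (k : ℕ) :
    MeasurableSet {p : ℝ × Path | p.2 ∈ jumpsBy k p.1} := by
  have : {p : ℝ × Path | p.2 ∈ jumpsBy k p.1} =
      ⋂ n, ⋂ (_ : n < k), {p : ℝ × Path | p.1 < jumpTime p.2 (n + 1)}ᶜ := by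
    ext p; simp [jumpsBy]
  rw [this]
  exact MeasurableSet.iInter fun n => MeasurableSet.iInter fun _ =>
    (measurableSet_lt_jumpTime (n + 1)).compl

theorem intervalIntegrable_exp_mul (l t a b : ℝ) {h : ℝ → ℝ} (hm : Measurable h) (C : ℝ)
    (hC : ∀ s, |h s| ≤ C) :
    IntervalIntegrable (fun s => Real.exp (-(l * (t - s))) * h s) volume a b := by
  have hc : IntervalIntegrable (fun s => Real.exp (-(l * (t - s)))) volume a b := by
    apply Continuous.intervalIntegrable; fun_prop
  rw [intervalIntegrable_iff] at hc ⊢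
  exact hc.mul_bdd hm.aestronglyMeasurable (c := C) (Eventually.of_forall hC)

theorem integral_exp_neg_mul_exp {l θ : ℝ} (h : 0 < l + θ) (t : ℝ) :
    ∫ s in (0 : ℝ)..t, Real.exp (-(l * (t - s))) * Real.exp (θ * s)
      = (Real.exp (θ * t) - Real.exp (-(l * t))) / (l + θ) := by
  have hd : ∀ s ∈ Set.uIcc 0 t, HasDerivAt (fun s => Real.exp (-(l * t)) *
      (Real.exp ((l + θ) * s) / (l + θ))) (Real.exp (-(l * (t - s))) * Real.exp (θ * s)) s := by
    intro s _
    have h1 : HasDerivAt (fun s => Real.exp ((l + θ) * s)) (Real.exp ((l + θ) * s) * (l + θ)) s := by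
      simpa using ((hasDerivAt_id s).const_mul (l + θ)).exp
    convert! (h1.div_const (l + θ)).const_mul (Real.exp (-(l * t))) using 1
    rw [mul_div_assoc, div_self h.ne', mul_one, ← Real.exp_add, ← Real.exp_add]
    ring_nf
  rw [intervalIntegral.integral_eq_sub_of_hasDerivAt hd
    (by apply Continuous.intervalIntegrable; fun_prop)]
  rw [mul_div_assoc', mul_div_assoc', ← Real.exp_add, ← sub_div]
  simp only [mul_zero, Real.exp_zero, mul_one]
  ring_nf

/-- Large configurations are paid for by the term `ε * η.degree`; small ones have exit rate at most
`L`, so each transition gains a factor `ρ` after discounting time by `exp (-(r + 1) t)`. In the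
exponent, `r` absorbs the growth of the expected degree, and the extra 1 keeps `ρ < 1` even for `r =
0`. -/
theorem law_jumpsBy_le {ε : ℝ} (hε : 0 < ε) : ∃ ρ : ℝ, 0 ≤ ρ ∧ ρ < 1 ∧ ∀ (k : ℕ) (t : ℝ)
    (η : Config), 0 ≤ t → η ≠ 0 → (law r μ η).real (jumpsBy k t)
      ≤ Real.exp ((r + 1) * t) * (ε * η.degree + ρ ^ k) := by
  -- Bounds the exit rate of configurations with at most `1 / ε` particles.
  set L : ℝ := 1 / ε * (1 + r) + (1 / ε) ^ 2 * μ with hL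
  have hL0 : 0 ≤ L := by positivity
  have hr : (0 : ℝ) ≤ r := r.2
  refine ⟨L / (L + (r + 1)), by positivity, by rw [div_lt_one] <;> linarith, fun k => ?_⟩
  set ρ : ℝ := L / (L + (r + 1)) with hρ
  have hρ0 : 0 ≤ ρ := by positivity
  induction k with
  | zero =>
    intro t η ht _
    calc _ ≤ (1 : ℝ) * 1 := by rw [mul_one]; exact measureReal_le_one
      _ ≤ _ := by
        refine mul_le_mul (Real.one_le_exp (by positivity)) ?_ zero_le_one (Real.exp_pos _).le
        rw [pow_zero]
        have : 0 ≤ ε * (η.degree : ℝ) := by positivity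
        linarith
  | succ k ih =>
    intro t η ht hη
    rcases le_or_gt 1 (ε * (η.degree : ℝ)) with hN | hN
    · calc _ ≤ (1 : ℝ) * 1 := by rw [mul_one]; exact measureReal_le_one
        _ ≤ _ := by
          refine mul_le_mul (Real.one_le_exp (by positivity)) ?_ zero_le_one (Real.exp_pos _).le
          have : 0 ≤ ρ ^ (k + 1) := by positivity
          linarith
    · have hl : (0 : ℝ) < exitRate r μ η := exitRate_pos r μ hη
      set l : ℝ := (exitRate r μ η : ℝ) with hldef
      have hlL : l ≤ L := by
        have hN' : (η.degree : ℝ) ≤ 1 / ε := by rw [le_div_iff₀ hε]; linarith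
        refine (exitRate_le_degree r μ η).trans ?_
        rw [hL]
        gcongr
      have hlθ : 0 < l + (r + 1) := by linarith
      have hlρ : l / (l + (r + 1)) ≤ ρ := by
        rw [hρ, div_le_div_iff₀ hlθ (by linarith)]
        nlinarith
      rw [law_real_eq_of_cons r μ hη ∅ (measurableSet_jumpsBy (k + 1))
        (measurableSet_jumpsBy k) (cons_mem_jumpsBy k) ht, Set.indicator_empty, mul_zero, zero_add]
      -- Bounds the rates applied to the induction hypothesis, up to the factor `exp ((r + 1) s)`.
      set D : ℝ := ε * ((l + r) * η.degree) + ρ ^ k * l with hD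
      have hD0 : 0 ≤ D := by positivity
      have hpt : ∀ s, 0 ≤ s → ratesSum r μ (fun ζ => (law r μ ζ).real (jumpsBy k s)) η
          ≤ Real.exp ((r + 1) * s) * D := by
        intro s hs
        calc _ ≤ ratesSum r μ (fun ζ => Real.exp ((r + 1) * s)
              * (ε * ζ.degree + ρ ^ k * 1)) η := by
              refine ratesSum_le_of_ne_zero r μ (fun ζ hζ => ?_) η
              rw [mul_one]
              exact ih s ζ hs hζ
          _ = Real.exp ((r + 1) * s) * (ε * ratesSum r μ (fun ζ => (ζ.degree : ℝ)) η
                + ρ ^ k * l) := by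
              rw [ratesSum_const_mul, ratesSum_add, ratesSum_const_mul, ratesSum_const_mul,
                ratesSum_one]
          _ ≤ _ := by
              refine mul_le_mul_of_nonneg_left ?_ (Real.exp_pos _).le
              rw [hD]
              exact add_le_add_left
                (mul_le_mul_of_nonneg_left (ratesSum_degree_le r μ η) hε.le) _
      calc _ ≤ ∫ s in (0 : ℝ)..t, Real.exp (-(l * (t - s))) * Real.exp ((r + 1) * s) * D := by
            refine intervalIntegral.integral_mono_on ht ?_ ?_ ?_
            · exact intervalIntegrable_exp_mul l t 0 t (measurable_ratesSum r μ
                (fun ζ => measurable_law_real r μ (measurableSet_jumpsBy k) ζ) η) l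
                fun s => abs_ratesSum_le r μ (fun _ => measureReal_nonneg)
                  (fun _ => measureReal_le_one) η
            · apply Continuous.intervalIntegrable; fun_prop
            · intro s hs
              rw [mul_assoc]
              exact mul_le_mul_of_nonneg_left (hpt s hs.1) (Real.exp_pos _).le
        _ = (Real.exp ((r + 1) * t) - Real.exp (-(l * t))) / (l + (r + 1)) * D := by
            rw [intervalIntegral.integral_mul_const, integral_exp_neg_mul_exp hlθ]
        _ ≤ Real.exp ((r + 1) * t) / (l + (r + 1)) * D := by
            gcongr
            linarith [Real.exp_pos (-(l * t))]
        _ = Real.exp ((r + 1) * t) * (ε * ((l + r) / (l + (r + 1)) * η.degree)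
              + ρ ^ k * (l / (l + (r + 1)))) := by
            rw [hD]; field_simp
        _ ≤ _ := by
            have h1 : (l + r) / (l + (r + 1)) ≤ 1 := by rw [div_le_one hlθ]; linarith
            have h2 : (l + r) / (l + (r + 1)) * (η.degree : ℝ) ≤ η.degree :=
              mul_le_of_le_one_left (Nat.cast_nonneg _) h1
            rw [pow_succ]
            gcongr

/-- The process does not explode. -/
theorem tendsto_law_jumpsBy {t : ℝ} (ht : 0 ≤ t) {η : Config} (hη : η ≠ 0) :
    Tendsto (fun k => (law r μ η).real (jumpsBy k t)) atTop (𝓝 0) := by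
  rw [Metric.tendsto_atTop]
  intro e he
  set M : ℝ := Real.exp ((r + 1) * t) with hM
  have hM0 : 0 < M := Real.exp_pos _
  have hd : (0 : ℝ) ≤ η.degree := Nat.cast_nonneg _
  set ε : ℝ := e / (2 * M * (η.degree + 1)) with hε
  obtain ⟨ρ, h0, h1, H⟩ := law_jumpsBy_le r μ (ε := ε) (by positivity)
  obtain ⟨K, hK⟩ := exists_pow_lt_of_lt_one (x := e / (2 * M)) (by positivity) h1
  refine ⟨K, fun k hk => ?_⟩
  rw [Real.dist_eq, sub_zero, abs_of_nonneg measureReal_nonneg]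
  refine (H k t η ht hη).trans_lt ?_
  have h2 : ρ ^ k ≤ ρ ^ K := pow_le_pow_of_le_one h0 h1.le hk
  have h3 : ε * η.degree ≤ e / (2 * M) := by
    rw [hε, div_mul_eq_mul_div, div_le_div_iff₀ (by positivity) (by positivity)]
    have : 0 ≤ e * (2 * M) := by positivity
    nlinarith
  calc M * (ε * η.degree + ρ ^ k) < M * (e / (2 * M) + e / (2 * M)) := by
        exact mul_lt_mul_of_pos_left (add_lt_add_of_le_of_lt h3 (h2.trans_lt hK)) hM0
    _ = e := by field_simp; ring

theorem law_visits_le (B : Set Config) (k : ℕ) (t : ℝ) (η : Config) :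
    (law r μ η).real (visits B t)
      ≤ (law r μ η).real (visitsWithin B k t) + (law r μ η).real (jumpsBy k t) := by
  refine (measureReal_mono ?_).trans (measureReal_union_le _ _)
  intro ω hω
  by_cases h : ∃ n < k, t < jumpTime ω (n + 1)
  · exact Or.inl ⟨hω, h⟩
  · push Not at h
    exact Or.inr h

end CBRW

/-! ### Occupation probabilities and the backward equation -/

namespace CBRW

variable (r μ : ℝ≥0)

/-- The probability that the process started from `η` is in `B` at time `t`. -/
noncomputable def occ (B : Set Config) (t : ℝ) (η : Config) : ℝ := (law r μ η).real (visits B t)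

/-- The probability that the process started from `η` is in `B` at time `t` after fewer than `k`
transitions. -/
noncomputable def occWithin (B : Set Config) (k : ℕ) (t : ℝ) (η : Config) : ℝ :=
  (law r μ η).real (visitsWithin B k t)

variable (B : Set Config)

theorem occ_nonneg (t : ℝ) (η : Config) : 0 ≤ occ r μ B t η := measureReal_nonneg
theorem occ_le_one (t : ℝ) (η : Config) : occ r μ B t η ≤ 1 := measureReal_le_one
theorem occWithin_nonneg (k : ℕ) (t : ℝ) (η : Config) : 0 ≤ occWithin r μ B k t η :=
  measureReal_nonneg
theorem occWithin_le_one (k : ℕ) (t : ℝ) (η : Config) : occWithin r μ B k t η ≤ 1 :=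
  measureReal_le_one

theorem occWithin_zero (t : ℝ) (η : Config) : occWithin r μ B 0 t η = 0 := by
  simp [occWithin, visitsWithin]

theorem measurable_occ (η : Config) : Measurable fun t => occ r μ B t η :=
  measurable_law_real r μ (measurableSet_visits B) η

theorem measurable_occWithin (k : ℕ) (η : Config) : Measurable fun t => occWithin r μ B k t η :=
  measurable_law_real r μ (measurableSet_visitsWithin B k) η

theorem measurable_ratesSum_occ (η : Config) :
    Measurable fun s => ratesSum r μ (occ r μ B s) η :=
  measurable_ratesSum r μ (measurable_occ r μ B) η

theorem abs_ratesSum_occ_le (s : ℝ) (η : Config) :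
    |ratesSum r μ (occ r μ B s) η| ≤ exitRate r μ η :=
  abs_ratesSum_le r μ (occ_nonneg r μ B s) (occ_le_one r μ B s) η

open Classical in
theorem occ_eq {η : Config} (hη : η ≠ 0) {t : ℝ} (ht : 0 ≤ t) :
    occ r μ B t η = Real.exp (-(exitRate r μ η * t)) * B.indicator 1 η
      + ∫ s in (0 : ℝ)..t, Real.exp (-(exitRate r μ η * (t - s))) *
          ratesSum r μ (occ r μ B s) η :=
  law_real_eq_of_cons r μ hη B (measurableSet_visits B) (measurableSet_visits B)
    (cons_mem_visits B) ht

open Classical in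
theorem occWithin_succ_eq {η : Config} (hη : η ≠ 0) (k : ℕ) {t : ℝ} (ht : 0 ≤ t) :
    occWithin r μ B (k + 1) t η = Real.exp (-(exitRate r μ η * t)) * B.indicator 1 η
      + ∫ s in (0 : ℝ)..t, Real.exp (-(exitRate r μ η * (t - s))) *
          ratesSum r μ (occWithin r μ B k s) η :=
  law_real_eq_of_cons r μ hη B (measurableSet_visitsWithin B (k + 1))
    (measurableSet_visitsWithin B k) (cons_mem_visitsWithin B k) ht

open Classical in
theorem occ_zero {η : Config} (hη : η ≠ 0) : occ r μ B 0 η = B.indicator 1 η := by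
  rw [occ_eq r μ B hη le_rfl]; simp

/-- The integral equation holds only for `t ≥ 0`; a continuous function on all of ℝ allows two-sided
differentiation at the endpoint 0. -/
theorem exists_continuous_eq_occ {η : Config} (hη : η ≠ 0) :
    ∃ G : ℝ → ℝ, Continuous G ∧ ∀ t, 0 ≤ t → occ r μ B t η = G t := by
  classical
  have hi : ∀ a b, IntervalIntegrable
      (fun s => Real.exp (-(exitRate r μ η * (0 - s))) * ratesSum r μ (occ r μ B s) η)
      volume a b := fun a b =>
    intervalIntegrable_exp_mul _ _ a b (measurable_ratesSum_occ r μ B η) _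
      fun s => abs_ratesSum_occ_le r μ B s η
  refine ⟨fun t => Real.exp (-(exitRate r μ η * t)) * (B.indicator 1 η
    + ∫ s in (0 : ℝ)..t, Real.exp (-(exitRate r μ η * (0 - s))) *
          ratesSum r μ (occ r μ B s) η), ?_, fun t ht => ?_⟩
  · exact Continuous.mul (by fun_prop)
      (continuous_const.add (intervalIntegral.continuous_primitive hi 0))
  · rw [occ_eq r μ B hη ht]
    beta_reduce
    rw [mul_add, ← intervalIntegral.integral_const_mul]
    congr 1
    refine intervalIntegral.integral_congr fun s _ => ?_
    rw [← mul_assoc, ← Real.exp_add]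
    ring_nf

theorem exists_continuous_eq_ratesSum_occ (η : Config) :
    ∃ G : ℝ → ℝ, Continuous G ∧ ∀ t, 0 ≤ t → ratesSum r μ (occ r μ B t) η = G t := by
  classical
  choose! G hG hG' using fun ζ (hζ : ζ ≠ 0) => exists_continuous_eq_occ r μ B (η := ζ) hζ
  -- The empty configuration has no equation here, and its value is irrelevant because the rates
  -- never charge it.
  refine ⟨fun t => ratesSum r μ (fun ζ => if ζ = 0 then 0 else G ζ t) η, ?_, fun t ht => ?_⟩
  · refine continuous_ratesSum r μ (fun ζ => ?_) η
    split_ifs with h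
    · exact continuous_const
    · exact hG ζ h
  · refine ratesSum_congr r μ (fun ζ hζ => ?_) η
    rw [if_neg hζ, hG' ζ hζ t ht]

/-- Variation of constants for the backward equation, with an arbitrary rate `L`, restarted at
time `a`. -/
theorem occ_eq_of_le {η : Config} (hη : η ≠ 0) (L : ℝ) {a t : ℝ} (ha : 0 ≤ a) (hat : a ≤ t) :
    occ r μ B t η = Real.exp (-(L * (t - a))) * occ r μ B a η
      + ∫ s in a..t, Real.exp (-(L * (t - s))) *
          (ratesSum r μ (occ r μ B s) η + (L - exitRate r μ η) * occ r μ B s η) := by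
  classical
  obtain ⟨R, hR, hRe⟩ := exists_continuous_eq_ratesSum_occ r μ B η
  set l : ℝ := (exitRate r μ η : ℝ) with hl
  let G : ℝ → ℝ := fun t => Real.exp (-(l * t)) * (B.indicator 1 η
    + ∫ s in (0 : ℝ)..t, Real.exp (l * s) * R s)
  have hG : ∀ t, 0 ≤ t → occ r μ B t η = G t := fun t ht => by
    rw [occ_eq r μ B hη ht, ← hl]
    simp only [G]
    rw [mul_add, ← intervalIntegral.integral_const_mul]
    congr 1
    refine intervalIntegral.integral_congr fun s hs => ?_
    rw [Set.uIcc_of_le ht] at hs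
    rw [hRe s hs.1, ← mul_assoc, ← Real.exp_add]
    ring_nf
  have hexp : ∀ c s : ℝ, HasDerivAt (fun s => Real.exp (c * s)) (Real.exp (c * s) * c) s :=
    fun c s => by simpa using ((hasDerivAt_id s).const_mul c).exp
  have hcont : Continuous fun s => Real.exp (l * s) * R s := by fun_prop
  have hGd : ∀ s, HasDerivAt G (-l * G s + R s) s := fun s => by
    have h1 : HasDerivAt (fun t => ∫ s in (0 : ℝ)..t, Real.exp (l * s) * R s)
        (Real.exp (l * s) * R s) s :=
      hcont.integral_hasStrictDerivAt 0 s |>.hasDerivAt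
    have h2 := (hexp (-l) s).mul (h1.const_add (B.indicator 1 η))
    simp only [neg_mul] at h2 ⊢
    convert! h2 using 1
    have : Real.exp (-(l * s)) * (Real.exp (l * s) * R s) = R s := by
      rw [← mul_assoc, ← Real.exp_add]; simp
    rw [this]
    simp only [G]
    ring
  clear_value G
  have hGc : Continuous G := continuous_iff_continuousAt.mpr fun s => (hGd s).continuousAt
  -- `G' = -l G + R` is integrated with the factor `exp (L s)` instead of `exp (l s)`, which leaves
  -- the source term `(L - l) G`.
  have hd : ∀ s ∈ Set.uIcc a t, HasDerivAt (fun s => Real.exp (-(L * t)) * (Real.exp (L * s) * G s))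
      (Real.exp (-(L * (t - s))) * (R s + (L - l) * G s)) s := fun s _ => by
    convert! ((hexp L s).mul (hGd s)).const_mul (Real.exp (-(L * t))) using 1
    have : Real.exp (-(L * (t - s))) = Real.exp (-(L * t)) * Real.exp (L * s) := by
      rw [← Real.exp_add]; ring_nf
    rw [this]
    ring
  have hint : ∫ s in a..t, Real.exp (-(L * (t - s))) *
          (ratesSum r μ (occ r μ B s) η + (L - l) * occ r μ B s η)
      = ∫ s in a..t, Real.exp (-(L * (t - s))) * (R s + (L - l) * G s) := by
    refine intervalIntegral.integral_congr fun s hs => ?_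
    rw [Set.uIcc_of_le hat] at hs
    rw [hRe s (ha.trans hs.1), hG s (ha.trans hs.1)]
  rw [hint, intervalIntegral.integral_eq_sub_of_hasDerivAt hd
    (by apply Continuous.intervalIntegrable; fun_prop), hG t (ha.trans hat), hG a ha,
    ← mul_assoc, ← mul_assoc, ← Real.exp_add, ← Real.exp_add, neg_add_cancel, Real.exp_zero,
    one_mul, show -(L * (t - a)) = -(L * t) + L * a by ring]
  ring

end CBRW

/-! ### Attractiveness, translation invariance and supermultiplicativity -/

namespace CBRW

variable (r μ : ℝ≥0)

theorem tendsto_occWithin (B : Set Config) {t : ℝ} (ht : 0 ≤ t) {η : Config} (hη : η ≠ 0) :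
    Tendsto (fun k => occWithin r μ B k t η) atTop (𝓝 (occ r μ B t η)) := by
  have h := (tendsto_const_nhds (x := occ r μ B t η)).sub (tendsto_law_jumpsBy r μ ht hη)
  rw [sub_zero] at h
  refine tendsto_of_tendsto_of_tendsto_of_le_of_le h tendsto_const_nhds (fun k => ?_) fun k => ?_
  · have := law_visits_le r μ B k t η
    simp only [occ, occWithin]
    linarith
  · exact measureReal_mono fun ω hω => hω.1

theorem occ_add_occ_compl (B : Set Config) (t : ℝ) (η : Config) :
    occ r μ B t η + occ r μ Bᶜ t η = 1 :=
  probReal_add_probReal_compl (measurableSet_section (measurableSet_visits B) t)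

theorem ratesSum_eq_sum {S : Finset ℤ} (f : Config → ℝ) {η : Config} (h : η.support ⊆ S) :
    ratesSum r μ f η = ∑ x ∈ S,
      ((η x : ℝ) * (1 / 2) * f (η - single x + single (x + 1))
      + (η x : ℝ) * (1 / 2) * f (η - single x + single (x - 1))
      + (η x : ℝ) * r * f (η + single x)
      + ((η x).choose 2 : ℝ) * μ * f (η - single x)) := by
  refine Finset.sum_subset h fun x _ hx => ?_
  rw [Finsupp.notMem_support_iff] at hx
  simp [hx]

theorem support_mono_of_le {ζ η : Config} (h : ζ ≤ η) : ζ.support ⊆ η.support :=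
  Finsupp.support_mono h

/-- One transition of the coupling in which a configuration and a subconfiguration of it evolve
together, so that the order between them is preserved. -/
theorem ratesSum_coupling {ζ η : Config} (hle : ζ ≤ η) (hζ : ζ ≠ 0) {a b : Config → ℝ}
    (h : ∀ ζ' η', ζ' ≠ 0 → ζ' ≤ η' → a ζ' + b η' ≤ 1) :
    ratesSum r μ a ζ + ((exitRate r μ η : ℝ) - exitRate r μ ζ) * a ζ + ratesSum r μ b η
      ≤ exitRate r μ η := by
  rw [← ratesSum_one r μ ζ, ← ratesSum_one r μ η, ratesSum_eq_sum r μ a (support_mono_of_le hle),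
    ratesSum_eq_sum r μ _ (support_mono_of_le hle), ratesSum, ratesSum, ← Finset.sum_sub_distrib,
    Finset.sum_mul, ← Finset.sum_add_distrib, ← Finset.sum_add_distrib]
  refine Finset.sum_le_sum fun x _ => ?_
  have hx : ζ x ≤ η x := hle x
  have hsub : ζ - single x ≤ η - single x := tsub_le_tsub_right hle _
  have hsub' : ζ x < η x → ζ ≤ η - single x := fun hlt y => by
    have := hle y
    rcases eq_or_ne x y with rfl | hxy
    · simp only [single, Finsupp.coe_tsub, Pi.sub_apply, Finsupp.single_eq_same]
      omega
    · simpa [single, Finsupp.single_apply, hxy] using this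
  have hc : (ζ x).choose 2 ≤ (η x).choose 2 := Nat.choose_le_choose 2 hx
  have hpos : (0 : ℝ) ≤ (η x : ℝ) - ζ x := sub_nonneg.mpr (by exact_mod_cast hx)
  have hcpos : (0 : ℝ) ≤ ((η x).choose 2 : ℝ) - (ζ x).choose 2 :=
    sub_nonneg.mpr (by exact_mod_cast hc)
  -- Transitions of rate zero are exempt, since the configurations they lead to need not be ordered
  -- or nonempty.
  have key : ∀ {c u v : ℝ}, 0 ≤ c → (c ≠ 0 → u + v ≤ 1) → c * (u + v) ≤ c := fun {c u v} hc h => by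
    rcases eq_or_ne c 0 with rfl | h0
    · simp
    · exact mul_le_of_le_one_right hc (h h0)
  have hlt : (η x : ℝ) - ζ x ≠ 0 → ζ x < η x := fun h0 =>
    lt_of_le_of_ne hx fun he => h0 (by rw [he, sub_self])
  have hclt : ((η x).choose 2 : ℝ) - (ζ x).choose 2 ≠ 0 → ζ x < η x := fun h0 =>
    lt_of_le_of_ne hx fun he => h0 (by rw [he, sub_self])
  -- The `ζ x` common particles and the pairs among them act in both configurations at once; the
  -- surplus particles and pairs act in `η` alone while `ζ` stays put.
  have hjump : ∀ y, (ζ x : ℝ) * (a (ζ - single x + single y) + b (η - single x + single y)) ≤ ζ x :=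
    fun y => key (Nat.cast_nonneg _) fun _ => h _ _ (add_single_ne_zero _ _) (by gcongr)
  have hjump' : ∀ y, ((η x : ℝ) - ζ x) * (a ζ + b (η - single x + single y)) ≤ η x - ζ x :=
    fun y => key hpos fun h0 => h _ _ hζ ((hsub' (hlt h0)).trans le_self_add)
  have hbranch : (ζ x : ℝ) * (a (ζ + single x) + b (η + single x)) ≤ ζ x :=
    key (Nat.cast_nonneg _) fun _ => h _ _ (add_single_ne_zero _ _) (by gcongr)
  have hbranch' : ((η x : ℝ) - ζ x) * (a ζ + b (η + single x)) ≤ η x - ζ x :=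
    key hpos fun _ => h _ _ hζ (hle.trans le_self_add)
  have hcoal : ((ζ x).choose 2 : ℝ) * (a (ζ - single x) + b (η - single x)) ≤ (ζ x).choose 2 :=
    key (Nat.cast_nonneg _) fun h0 => h _ _ (sub_single_ne_zero (by
      by_contra hlt
      exact h0 (by rw [Nat.choose_eq_zero_of_lt (by omega), Nat.cast_zero]))) hsub
  have hcoal' : (((η x).choose 2 : ℝ) - (ζ x).choose 2) * (a ζ + b (η - single x))
      ≤ (η x).choose 2 - (ζ x).choose 2 :=
    key hcpos fun h0 => h _ _ hζ (hsub' (hclt h0))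
  have h1 := hjump (x + 1)
  have h2 := hjump (x - 1)
  have h3 := hjump' (x + 1)
  have h4 := hjump' (x - 1)
  have h5 := mul_le_mul_of_nonneg_left hbranch r.2
  have h6 := mul_le_mul_of_nonneg_left hbranch' r.2
  have h7 := mul_le_mul_of_nonneg_left hcoal μ.2
  have h8 := mul_le_mul_of_nonneg_left hcoal' μ.2
  simp only [NNReal.val_eq_coe] at h5 h6 h7 h8
  linarith

/-- Under an order-preserving coupling, `ζ` in `B` and `η` in `Bᶜ` exclude each other, so the
probabilities sum to at most 1. In this form the claim passes through the backward equations: the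
one for `ζ` is written with the exit rate of `η`, so that both have the same exponential kernel, and
`ratesSum_coupling` bounds the sum of the sources. -/
theorem occ_add_occWithin_le {B : Set Config} (hB : IsUpperSet B) (k : ℕ) :
    ∀ {t : ℝ}, 0 ≤ t → ∀ ζ η : Config, ζ ≠ 0 → ζ ≤ η →
      occ r μ B t ζ + occWithin r μ Bᶜ k t η ≤ 1 := by
  classical
  induction k with
  | zero =>
    intro t _ ζ η _ _
    rw [occWithin_zero, add_zero]
    exact occ_le_one r μ B t ζ
  | succ k ih =>
    intro t ht ζ η hζ hle
    have hη : η ≠ 0 := fun h0 => hζ (le_antisymm (h0 ▸ hle) zero_le)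
    have hl : (0 : ℝ) < exitRate r μ η := exitRate_pos r μ hη
    set l : ℝ := (exitRate r μ η : ℝ) with hldef
    rw [occ_eq_of_le r μ B hζ l le_rfl ht, occWithin_succ_eq r μ Bᶜ hη k ht, sub_zero,
      occ_zero r μ B hζ]
    have hind : B.indicator (1 : Config → ℝ) ζ + Bᶜ.indicator (1 : Config → ℝ) η ≤ 1 := by
      by_cases h1 : ζ ∈ B
      · simp [h1, hB hle h1]
      · by_cases h2 : η ∈ B <;> simp [h1, h2]
    have hi1 : IntervalIntegrable (fun s => Real.exp (-(l * (t - s))) *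
        (ratesSum r μ (occ r μ B s) ζ + (l - exitRate r μ ζ) * occ r μ B s ζ)) volume 0 t := by
      refine intervalIntegrable_exp_mul l t 0 t ((measurable_ratesSum_occ r μ B ζ).add
        ((measurable_occ r μ B ζ).const_mul _))
        (exitRate r μ ζ + |l - exitRate r μ ζ| * 1) fun s => ?_
      refine (abs_add_le _ _).trans (add_le_add (abs_ratesSum_occ_le r μ B s ζ) ?_)
      rw [abs_mul, abs_of_nonneg (occ_nonneg r μ B s ζ)]
      gcongr
      exact occ_le_one r μ B s ζ
    have hi2 : IntervalIntegrable (fun s => Real.exp (-(l * (t - s))) *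
        ratesSum r μ (occWithin r μ Bᶜ k s) η) volume 0 t :=
      intervalIntegrable_exp_mul l t 0 t
        (measurable_ratesSum r μ (measurable_occWithin r μ Bᶜ k) η) l
        fun s => abs_ratesSum_le r μ (occWithin_nonneg r μ Bᶜ k s) (occWithin_le_one r μ Bᶜ k s) η
    -- The factor `exp (0 * s)` brings the bound into the form of `integral_exp_neg_mul_exp` with `θ
    -- = 0`.
    have hint := intervalIntegral.integral_mono_on (g := fun s => l *
      (Real.exp (-(l * (t - s))) * Real.exp (0 * s))) ht (hi1.add hi2)
      (by apply Continuous.intervalIntegrable; fun_prop) fun s hs => by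
        have := ratesSum_coupling r μ hle hζ fun ζ' η' h0 h1 => ih hs.1 ζ' η' h0 h1
        have := mul_le_mul_of_nonneg_left this (Real.exp_pos (-(l * (t - s)))).le
        rw [zero_mul, Real.exp_zero]
        linarith
    rw [intervalIntegral.integral_add hi1 hi2, intervalIntegral.integral_const_mul,
      integral_exp_neg_mul_exp (by linarith), zero_mul, Real.exp_zero, add_zero,
      mul_div_cancel₀ _ hl.ne'] at hint
    have := mul_le_mul_of_nonneg_left hind (Real.exp_pos (-(l * t))).le
    linarith

/-- The process is attractive: the probability of an increasing event at time `t` is monotone in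
the initial configuration. -/
theorem occ_mono_left {B : Set Config} (hB : IsUpperSet B) {t : ℝ} (ht : 0 ≤ t) {ζ η : Config}
    (hζ : ζ ≠ 0) (hle : ζ ≤ η) : occ r μ B t ζ ≤ occ r μ B t η := by
  have hη : η ≠ 0 := fun h0 => hζ (le_antisymm (h0 ▸ hle) zero_le)
  have h := (tendsto_occWithin r μ Bᶜ ht hη).const_add (occ r μ B t ζ)
  have h1 := le_of_tendsto' h fun k => occ_add_occWithin_le r μ hB k ht ζ η hζ hle
  have := occ_add_occ_compl r μ B t η
  linarith

/-- Translation of a configuration. -/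
noncomputable def shift (y : ℤ) (η : Config) : Config := η.equivMapDomain (Equiv.addRight y)

theorem shift_apply (y : ℤ) (η : Config) (z : ℤ) : shift y η z = η (z - y) := by
  simp [shift, sub_eq_add_neg]

theorem shift_single (y x : ℤ) : shift y (single x) = single (x + y) := by
  simp [shift, single]

theorem shift_add (y : ℤ) (η ζ : Config) : shift y (η + ζ) = shift y η + shift y ζ := by
  ext z; simp [shift_apply]

theorem shift_sub (y : ℤ) (η ζ : Config) : shift y (η - ζ) = shift y η - shift y ζ := by
  ext z; simp [shift_apply]

theorem shift_ne_zero (y : ℤ) {η : Config} (hη : η ≠ 0) : shift y η ≠ 0 := fun h => hη (by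
  ext z
  have := DFunLike.congr_fun h (z + y)
  simpa [shift_apply] using this)

theorem ratesSum_shift (y : ℤ) (f : Config → ℝ) (η : Config) :
    ratesSum r μ f (shift y η) = ratesSum r μ (fun ζ => f (shift y ζ)) η := by
  have hs : (shift y η).support = η.support.map (Equiv.addRight y).toEmbedding := rfl
  rw [ratesSum, hs, Finset.sum_map, ratesSum]
  refine Finset.sum_congr rfl fun x _ => ?_
  simp only [shift_add, shift_sub, shift_single, Equiv.coe_toEmbedding, Equiv.coe_addRight,
    shift_apply, add_sub_cancel_right]
  rw [show x + y + 1 = x + 1 + y by ring, show x + y - 1 = x - 1 + y by ring]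

theorem exitRate_shift (y : ℤ) (η : Config) : (exitRate r μ (shift y η) : ℝ) = exitRate r μ η := by
  rw [← ratesSum_one, ← ratesSum_one, ratesSum_shift]

theorem occWithin_shift (y : ℤ) (B : Set Config) (k : ℕ) : ∀ {t : ℝ}, 0 ≤ t → ∀ {η : Config},
    η ≠ 0 → occWithin r μ B k t (shift y η) = occWithin r μ (shift y ⁻¹' B) k t η := by
  classical
  induction k with
  | zero => intro t _ η _; simp [occWithin_zero]
  | succ k ih =>
    intro t ht η hη
    rw [occWithin_succ_eq r μ B (shift_ne_zero y hη) k ht, occWithin_succ_eq r μ _ hη k ht,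
      exitRate_shift]
    congr 1
    refine intervalIntegral.integral_congr fun s hs => ?_
    rw [Set.uIcc_of_le ht] at hs
    rw [ratesSum_shift]
    congr 1
    exact ratesSum_congr r μ (fun ζ hζ => ih hs.1 hζ) η

theorem occ_shift (y : ℤ) (B : Set Config) {t : ℝ} (ht : 0 ≤ t) {η : Config} (hη : η ≠ 0) :
    occ r μ B t (shift y η) = occ r μ (shift y ⁻¹' B) t η := by
  refine tendsto_nhds_unique (tendsto_occWithin r μ B ht (shift_ne_zero y hη)) ?_
  simp_rw [occWithin_shift r μ y B _ ht hη]
  exact tendsto_occWithin r μ _ ht hη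

/-- Configurations with a particle at or to the right of the site `m`. -/
def beyond (m : ℤ) : Set Config := {η | ∃ x ∈ η.support, m ≤ x}

theorem isUpperSet_beyond (m : ℤ) : IsUpperSet (beyond m) := fun _ _ hle ⟨x, hx, hm⟩ =>
  ⟨x, support_mono_of_le hle hx, hm⟩

theorem single_mem_beyond (x : ℤ) : single x ∈ beyond x := ⟨x, by simp [single], le_rfl⟩

theorem beyond_anti {m n : ℤ} (h : m ≤ n) : beyond n ⊆ beyond m := fun _ ⟨x, hx, hn⟩ =>
  ⟨x, hx, h.trans hn⟩

theorem shift_preimage_beyond (y m : ℤ) : shift y ⁻¹' beyond m = beyond (m - y) := by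
  ext η
  simp only [beyond, Set.mem_preimage, Set.mem_ofPred_eq, Finsupp.mem_support_iff, shift_apply]
  constructor
  · rintro ⟨x, hx, hm⟩
    exact ⟨x - y, hx, by omega⟩
  · rintro ⟨x, hx, hm⟩
    exact ⟨x + y, by simpa using hx, by omega⟩

theorem occ_mono_set {B C : Set Config} (h : B ⊆ C) (t : ℝ) (η : Config) :
    occ r μ B t η ≤ occ r μ C t η := measureReal_mono fun _ hω => h hω

/-- The probability that at time `t` there is a particle at or to the right of the site `m`. -/
noncomputable def rightTail (t : ℝ) (m : ℤ) : ℝ := occ r μ (beyond m) t (single 0)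

/-- Attractiveness allows keeping a single particle at some `x ≥ m`, which is then translated to the
origin. -/
theorem rightTail_le_occ {t : ℝ} (ht : 0 ≤ t) {m n : ℤ} {η : Config} (hη : η ∈ beyond m) :
    rightTail r μ t n ≤ occ r μ (beyond (m + n)) t η := by
  obtain ⟨x, hx, hm⟩ := hη
  calc rightTail r μ t n ≤ occ r μ (beyond (m + n - x)) t (single 0) :=
        occ_mono_set r μ (beyond_anti (by omega)) t _
    _ = occ r μ (beyond (m + n)) t (single x) := by
        rw [← shift_preimage_beyond, ← occ_shift r μ x _ ht (single_ne_zero 0), shift_single,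
          zero_add]
    _ ≤ _ := occ_mono_left r μ (isUpperSet_beyond _) ht (single_ne_zero x) (single_le hx)

/-- The Markov property at time `s`, as an inequality. Both sides satisfy the same first-step
equation in `s`, the right one being restarted at time `t`; the boundary terms are compared by
`rightTail_le_occ`. -/
theorem occWithin_mul_rightTail_le (k : ℕ) {t : ℝ} (ht : 0 ≤ t) (m n : ℤ) :
    ∀ {s : ℝ}, 0 ≤ s → ∀ {η : Config}, η ≠ 0 →
      occWithin r μ (beyond m) k s η * rightTail r μ t n
        ≤ occ r μ (beyond (m + n)) (s + t) η := by
  classical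
  induction k with
  | zero =>
    intro s _ η _
    rw [occWithin_zero, zero_mul]
    exact occ_nonneg _ _ _ _ _
  | succ k ih =>
    intro s hs η hη
    have hq : 0 ≤ rightTail r μ t n := occ_nonneg _ _ _ _ _
    set q := rightTail r μ t n with hqdef
    set l : ℝ := (exitRate r μ η : ℝ) with hldef
    rw [occWithin_succ_eq r μ _ hη k hs, occ_eq_of_le r μ _ hη l ht (by linarith),
      add_sub_cancel_right, add_mul, ← hldef, sub_self]
    refine add_le_add ?_ ?_
    · rw [mul_assoc]
      refine mul_le_mul_of_nonneg_left ?_ (Real.exp_pos _).le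
      by_cases hm : η ∈ beyond m
      · rw [Set.indicator_of_mem hm, Pi.one_apply, one_mul]
        exact rightTail_le_occ r μ ht hm
      · rw [Set.indicator_of_notMem hm, zero_mul]
        exact occ_nonneg _ _ _ _ _
    -- The integral over `[t, s + t]` is moved to `[0, s]`.
    · have hsub := intervalIntegral.integral_comp_add_right (a := 0) (b := s)
        (fun u => Real.exp (-(l * (s + t - u))) * (ratesSum r μ (occ r μ (beyond (m + n)) u) η
          + 0 * occ r μ (beyond (m + n)) u η)) t
      rw [zero_add] at hsub
      rw [← hsub, ← intervalIntegral.integral_mul_const]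
      simp only [zero_mul, add_zero, add_sub_add_right_eq_sub]
      refine intervalIntegral.integral_mono_on hs ?_ ?_ fun u hu => ?_
      · exact (intervalIntegrable_exp_mul l s 0 s
          (measurable_ratesSum r μ (measurable_occWithin r μ (beyond m) k) η) l
          fun u => abs_ratesSum_le r μ (occWithin_nonneg r μ _ k u)
            (occWithin_le_one r μ _ k u) η).mul_const q
      · exact intervalIntegrable_exp_mul l s 0 s
          ((measurable_ratesSum_occ r μ _ η).comp (measurable_add_const t)) l
          fun u => abs_ratesSum_occ_le r μ _ _ η
      · rw [mul_assoc]
        refine mul_le_mul_of_nonneg_left ?_ (Real.exp_pos _).le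
        rw [mul_comm, ← ratesSum_const_mul]
        refine ratesSum_le_of_ne_zero r μ (fun ζ hζ => ?_) η
        rw [mul_comm]
        exact ih hu.1 hζ

theorem rightTail_mul_le {s t : ℝ} (hs : 0 ≤ s) (ht : 0 ≤ t) (m n : ℤ) :
    rightTail r μ s m * rightTail r μ t n ≤ rightTail r μ (s + t) (m + n) :=
  le_of_tendsto' ((tendsto_occWithin r μ (beyond m) hs (single_ne_zero 0)).mul_const _)
    fun k => occWithin_mul_rightTail_le r μ k ht m n hs (single_ne_zero 0)

theorem rightTail_anti (t : ℝ) {m n : ℤ} (h : m ≤ n) : rightTail r μ t n ≤ rightTail r μ t m :=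
  occ_mono_set r μ (beyond_anti h) t _

theorem exitRate_single (x : ℤ) : (exitRate r μ (single x) : ℝ) = 1 + r := by
  simp [exitRate, single]

theorem exp_le_occ_single {t : ℝ} (ht : 0 ≤ t) (x : ℤ) :
    Real.exp (-((1 + r) * t)) ≤ occ r μ (beyond x) t (single x) := by
  classical
  rw [occ_eq r μ _ (single_ne_zero x) ht, Set.indicator_of_mem (single_mem_beyond x),
    exitRate_single, Pi.one_apply, mul_one]
  refine le_add_of_nonneg_right (intervalIntegral.integral_nonneg ht fun s _ => ?_)
  exact mul_nonneg (Real.exp_pos _).le (ratesSum_nonneg r μ (occ_nonneg r μ _ s) _)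

theorem exp_le_rightTail_zero {t : ℝ} (ht : 0 ≤ t) :
    Real.exp (-((1 + r) * t)) ≤ rightTail r μ t 0 := exp_le_occ_single r μ ht 0

/-- One scenario suffices: the particle jumps right once, at rate 1/2, and nothing else happens up
to time `t`. Its density `exp (-((1 + r) t)) / 2` does not depend on the time of the jump. -/
theorem exp_le_rightTail_one {t : ℝ} (ht : 0 ≤ t) :
    t / 2 * Real.exp (-((1 + r) * t)) ≤ rightTail r μ t 1 := by
  classical
  have hrates : ∀ s, 0 ≤ s → 1 / 2 * Real.exp (-((1 + r) * s))
      ≤ ratesSum r μ (occ r μ (beyond 1) s) (single 0) := fun s hs => by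
    have h0 := occ_nonneg r μ (beyond 1) s
    have h1 := exp_le_occ_single r μ hs 1
    have : 0 ≤ (r : ℝ) := r.2
    rw [ratesSum, single, Finsupp.support_single 0 one_ne_zero, Finset.sum_singleton]
    have e : Finsupp.single (0 : ℤ) 1 - single 0 + single (0 + 1) = single 1 := by
      simp [single]
    rw [e]
    simp only [Finsupp.single_eq_same, Nat.cast_one, one_mul]
    simp only [Nat.choose_succ_self, Nat.cast_zero, zero_mul, add_zero]
    exact le_add_of_le_of_nonneg (le_add_of_le_of_nonneg
      (mul_le_mul_of_nonneg_left h1 (by norm_num)) (mul_nonneg (by norm_num) (h0 _)))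
      (mul_nonneg this (h0 _))
  rw [rightTail, occ_eq r μ _ (single_ne_zero 0) ht, exitRate_single]
  refine le_add_of_nonneg_of_le
    (mul_nonneg (Real.exp_pos _).le (Set.indicator_nonneg (by simp) _)) ?_
  calc t / 2 * Real.exp (-((1 + r) * t))
      = ∫ s in (0 : ℝ)..t, 1 / 2 * Real.exp (-((1 + r) * t)) := by
        rw [intervalIntegral.integral_const, smul_eq_mul]; ring
    _ ≤ _ := by
        refine intervalIntegral.integral_mono_on ht (by simp) ?_ fun s hs => ?_
        · exact intervalIntegrable_exp_mul _ t 0 t (measurable_ratesSum_occ r μ _ _) _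
            fun s => abs_ratesSum_occ_le r μ _ s _
        · calc 1 / 2 * Real.exp (-((1 + r) * t))
              = Real.exp (-((1 + r) * (t - s))) * (1 / 2 * Real.exp (-((1 + r) * s))) := by
                rw [mul_left_comm, ← Real.exp_add]; ring_nf
            _ ≤ _ := mul_le_mul_of_nonneg_left (hrates s hs.1) (Real.exp_pos _).le

end CBRW

/-! ### Fekete's lemma, lower bounds and the limit -/

namespace CBRW

/-- Fekete's lemma for nonnegative subadditive functions on the positive half-line. -/
theorem exists_tendsto_div_of_subadditive {u : ℝ → ℝ} (h0 : ∀ t, 0 < t → 0 ≤ u t)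
    (hadd : ∀ s t, 0 < s → 0 < t → u (s + t) ≤ u s + u t)
    (hbdd : ∀ R, ∃ M, ∀ t, 1 ≤ t → t ≤ R → u t ≤ M) :
    ∃ ψ, 0 ≤ ψ ∧ Tendsto (fun t => u t / t) atTop (𝓝 ψ) := by
  set S : Set ℝ := (fun t => u t / t) '' Set.Ioi 0 with hS
  have hne : S.Nonempty := ⟨_, 1, Set.mem_Ioi.mpr one_pos, rfl⟩
  have hlow : ∀ y ∈ S, 0 ≤ y := by
    rintro _ ⟨t, ht, rfl⟩
    exact div_nonneg (h0 t ht) (le_of_lt ht)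
  have hmul : ∀ (n : ℕ) (T ρ : ℝ), 0 < T → 0 < ρ → u (n * T + ρ) ≤ n * u T + u ρ := by
    intro n T ρ hT hρ
    induction n with
    | zero => simp
    | succ n ih =>
      have h1 := hadd T (n * T + ρ) hT (by positivity)
      have e : ((n + 1 : ℕ) : ℝ) * T + ρ = T + (n * T + ρ) := by push_cast; ring
      rw [e]
      push_cast
      linarith
  refine ⟨sInf S, le_csInf hne hlow, ?_⟩
  rw [Metric.tendsto_atTop]
  intro ε hε
  obtain ⟨_, ⟨T, hT, rfl⟩, hlt⟩ := exists_lt_of_csInf_lt hne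
    (show sInf S < sInf S + ε / 2 by linarith)
  rw [Set.mem_Ioi] at hT
  obtain ⟨M, hM⟩ := hbdd (1 + T)
  -- Beyond this threshold the remainder contributes less than `ε / 2` to `u t / t`.
  refine ⟨max 1 (2 * |M| / ε + 1), fun t ht => ?_⟩
  have ht1 : 1 ≤ t := (le_max_left _ _).trans ht
  have ht2 : 2 * |M| / ε + 1 ≤ t := (le_max_right _ _).trans ht
  have ht0 : 0 < t := by linarith
  have hge : sInf S ≤ u t / t := csInf_le ⟨0, hlow⟩ ⟨t, ht0, rfl⟩
  rw [Real.dist_eq, abs_of_nonneg (by linarith)]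
  -- Using `t - 1` instead of `t` keeps the remainder `t - n * T` in `[1, 1 + T)`, away from 0,
  -- where `u` may be unbounded.
  set n := ⌊(t - 1) / T⌋₊ with hn
  have hn1 : (n : ℝ) * T ≤ t - 1 :=
    (le_div_iff₀ hT).mp (Nat.floor_le (div_nonneg (by linarith) hT.le))
  have hn2 : t - 1 < (n + 1) * T := (div_lt_iff₀ hT).mp (Nat.lt_floor_add_one _)
  have h1 := hmul n T (t - n * T) hT (by linarith)
  rw [add_sub_cancel] at h1
  have h2 := hM (t - n * T) (by linarith) (by linarith)
  have h3 : (n : ℝ) * u T ≤ t * (u T / T) := by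
    rw [mul_div_assoc', le_div_iff₀ hT]
    nlinarith [h0 T hT]
  have h4 : |M| < ε / 2 * t := by
    have : 2 * |M| / ε < t := by linarith
    rw [div_lt_iff₀ hε] at this
    linarith
  have h5 : u t < (sInf S + ε) * t := by
    have := le_abs_self M
    nlinarith
  have := (div_lt_iff₀ ht0).mpr h5
  linarith

variable (r μ : ℝ≥0)

theorem rightTail_one_pow_le {s : ℝ} (hs : 0 ≤ s) (n : ℕ) :
    rightTail r μ s 1 ^ n ≤ rightTail r μ (n * s) n := by
  induction n with
  | zero => simpa using exp_le_rightTail_zero r μ (t := 0) le_rfl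
  | succ n ih =>
    have h := rightTail_mul_le r μ (s := n * s) (t := s) (by positivity) hs n 1
    rw [pow_succ]
    push_cast
    rw [add_mul, one_mul]
    exact (mul_le_mul_of_nonneg_right ih (occ_nonneg _ _ _ _ _)).trans h

/-- One step to the right is forced in each of `n` time intervals of length `t / n`. -/
theorem le_rightTail {t : ℝ} (ht : 0 ≤ t) {n : ℕ} (hn : 0 < n) {m : ℤ} (hm : m ≤ n) :
    (t / n / 2) ^ n * Real.exp (-((1 + r) * t)) ≤ rightTail r μ t m := by
  have hn' : (0 : ℝ) < n := by exact_mod_cast hn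
  have hs : 0 ≤ t / n := by positivity
  have h := rightTail_one_pow_le r μ hs n
  rw [mul_div_cancel₀ _ hn'.ne'] at h
  refine le_trans ?_ (h.trans (rightTail_anti r μ t hm))
  have e : Real.exp (-((1 + r) * t)) = Real.exp (-((1 + r) * (t / n))) ^ n := by
    rw [← Real.exp_nat_mul]
    congr 1
    field_simp
  rw [e, ← mul_pow]
  exact pow_le_pow_left₀ (by positivity) (exp_le_rightTail_one r μ hs) n

theorem rightTail_pos {t : ℝ} (ht : 0 < t) (m : ℤ) : 0 < rightTail r μ t m :=
  lt_of_lt_of_le (by positivity) (le_rightTail r μ ht.le (n := m.toNat + 1) (Nat.succ_pos _)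
    (by have := Int.self_le_toNat m; omega))

/-- Rounding does no harm: `⌈c * (s + t)⌉ ≤ ⌈c * s⌉ + ⌈c * t⌉`, and `rightTail` decreases in the
site. -/
theorem exists_tendsto_log_rightTail (c : ℝ) :
    ∃ ψ, 0 ≤ ψ ∧ Tendsto (fun t : ℝ => -Real.log (rightTail r μ t ⌈c * t⌉) / t) atTop (𝓝 ψ) := by
  refine exists_tendsto_div_of_subadditive (fun t ht => ?_) (fun s t hs ht => ?_) fun R => ?_
  · exact neg_nonneg.mpr (Real.log_nonpos (occ_nonneg _ _ _ _ _) (occ_le_one _ _ _ _ _))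
  · have h1 : rightTail r μ s ⌈c * s⌉ * rightTail r μ t ⌈c * t⌉
        ≤ rightTail r μ (s + t) ⌈c * (s + t)⌉ :=
      (rightTail_mul_le r μ hs.le ht.le _ _).trans
        (rightTail_anti r μ _ (by rw [mul_add]; exact Int.ceil_add_le _ _))
    have hs' := rightTail_pos r μ hs ⌈c * s⌉
    have ht' := rightTail_pos r μ ht ⌈c * t⌉
    have h2 := Real.log_le_log (mul_pos hs' ht') h1
    rw [Real.log_mul hs'.ne' ht'.ne'] at h2
    linarith
  -- A single positive number of steps that suffices for every `t` in `[1, R]`.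
  · set n : ℕ := ⌈|c| * R⌉.toNat + 1 with hn
    refine ⟨-Real.log ((1 / n / 2) ^ n * Real.exp (-((1 + r) * R))), fun t h1 hR => ?_⟩
    have hn0 : 0 < n := Nat.succ_pos _
    have hm : ⌈c * t⌉ ≤ n := by
      have hle : c * t ≤ |c| * R :=
        mul_le_mul (le_abs_self c) hR (by linarith) (abs_nonneg c)
      have := Int.ceil_le_ceil hle
      have := Int.self_le_toNat ⌈|c| * R⌉
      omega
    refine neg_le_neg (Real.log_le_log (by positivity) (le_trans ?_
      (le_rightTail r μ (by linarith) hn0 hm)))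
    gcongr

theorem setOf_le_Xmax {σ : ℝ} (hσ : 0 < σ) (v t : ℝ) :
    {ω | ((v * t : ℝ) : EReal) ≤ Xmax σ t ω} = visits (beyond ⌈v / σ * t⌉) t := by
  ext ω
  simp only [visits, beyond, Set.mem_ofPred_eq, Xmax]
  -- A real bound lies above `⊥`, so it can only be reached by an actual particle; the empty
  -- configuration is excluded on both sides.
  rw [Finset.le_sup_iff (EReal.bot_lt_coe _)]
  refine exists_congr fun x => and_congr_right fun _ => ?_
  rw [EReal.coe_le_coe_iff, Int.ceil_le, div_mul_eq_mul_div, div_le_iff₀ hσ, mul_comm σ]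

end CBRW

theorem mainTheorem6 (σ : ℝ) (hσ : 0 < σ) (r μ : ℝ≥0) (v : ℝ) :
    (∀ t : ℝ, 0 < t →
      0 < (CBRW.law r μ (CBRW.single 0)).real {ω | ((v * t : ℝ) : EReal) ≤ CBRW.Xmax σ t ω}) ∧
    ∃ ψ : ℝ, 0 ≤ ψ ∧
      Tendsto
        (fun t : ℝ => 1 / t * Real.log
          ((CBRW.law r μ (CBRW.single 0)).real {ω | ((v * t : ℝ) : EReal) ≤ CBRW.Xmax σ t ω}))
        atTop (𝓝 (-ψ)) := by
  have key : ∀ t, (CBRW.law r μ (CBRW.single 0)).real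
      {ω | ((v * t : ℝ) : EReal) ≤ CBRW.Xmax σ t ω} = CBRW.rightTail r μ t ⌈v / σ * t⌉ :=
    fun t => by rw [CBRW.setOf_le_Xmax hσ]; rfl
  simp only [key]
  refine ⟨fun t ht => CBRW.rightTail_pos r μ ht _, ?_⟩
  obtain ⟨ψ, h0, h⟩ := CBRW.exists_tendsto_log_rightTail r μ (v / σ)
  refine ⟨ψ, h0, h.neg.congr fun t => ?_⟩
  ring
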